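/- **Theorem.** Let $R$ be a commutative ring with $1$. The category $\mathsf{DiGraph}$ of (small) directed graphs, with the cofibrations and the weak equivalences defined below, is a cofibration category, i.e. it satisfies (C1)–(C7). *Directed graphs.* A directed graph $X$ is a set $X_V$ of vertices with a reflexive binary relation; we write $x\to y$, and say that there is an edge from $x$ to $y$, when $x$ and $y$ are related. Maps $X\to Y$ are functions $X_V\to Y_V$ preserving the relation. A path of length $n$ from $x$ to $y$ is a sequence $x=x_0\to x_1\to\dots\to x_n=y$ (degenerate edges $x_i = x_{i+1}$ are allowed). *Cofibrations.* A map $A\to X$ is a cofibration if it is (isomorphic to) the inclusion of an induced subgraph $A$ of $X$ (i.e. it is injective on vertices and reflects edges) such that - there are no edges out of $A$: if $a\in A_V$ and $a\to x$ in $X$, then $x\in A_V$; - $X$ admits a projecting decomposition with respect to $A$: writing $X^A_V$ for the set of vertices of $X$ that admit a path to some vertex of $A$, there is a function $\pi\colon X^A_V\to A_V$ such that for all $x\in X_V^A$ and all $a\in A_V$ admitting a path from $x$, some path from $x$ to $a$ of minimal length passes through $\pi x$. *Weak equivalences.* Let $C_n(X)$ be the quotient of the free $R$-module on $X_V^{n+1}$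 by the submodule generated by the tuples $(x_0,\dots,x_n)$ with $x_i=x_{i+1}$ for some $i$, with differential induced by $\partial(x_0,\dots,x_n)=\sum_{i=0}^n(-1)^i(x_0,\dots,\widehat{x_i},\dots,x_n)$. Let $A_n(X)\subseteq C_n(X)$ be the submodule generated by the classes of the paths of length $n$ in $X$. Put $\Omega_0(X)=A_0(X)$ and $\Omega_n(X)=\{c\in A_n(X):\partial c\in A_{n-1}(X)\}$ for $n\ge 1$. Then $(\Omega_\bullet(X),\partial)$ is a chain complex, functorial in $X$; its homology $H_\bullet(X;R)$ is the path homology of $X$. A map $f\colon X\to Y$ is a weak equivalence if $f_*\colon H_n(X;R)\to H_n(Y;R)$ is an isomorphism for all $n\ge 0$. *Axioms of a cofibration category* (an acyclic cofibration is a map that is both a cofibration and a weak equivalence): - (C1) Identity maps are acyclic cofibrations; cofibrations and weak equivalences are each closed under composition. - (C2) For composable maps $f,g,h$, if $gf$ and $hg$ are weak equivalences, then so are $f$, $g$, $h$ and $hgf$. - (C3) There is an initial object $\varnothing$, and for every object $X$ the map $\varnothing\to X$ is a cofibration. - (C4) Pushouts along cofibrations exist; the pushout of a cofibration is a cofibration,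 and the pushout of an acyclic cofibration is an acyclic cofibration. - (C5) For every object $X$, the codiagonal $X\sqcup X\to X$ factors as a cofibration followed by a weak equivalence. - (C6) Small coproducts exist. - (C7) Transfinite composites of cofibrations exist and are cofibrations, and transfinite composites of acyclic cofibrations are acyclic cofibrations. -/

import Mathlib

open CategoryTheory CategoryTheory.Limits

universe w v u

/-! ### Cofibration categories -/

/-- The axioms of a cofibration category, for a category `C` with a class `cof` of
cofibrations and a class `weq` of weak equivalences. `cof ⊓ weq` is the class of acyclic
cofibrations. The universe `w` is the one with respect to which "small" is understood. -/
structure IsCofibrationCategory {C : Type u} [Category.{v} C]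
    (cof weq : MorphismProperty C) : Prop where
  /-- Identities are acyclic cofibrations. -/
  id_mem (X : C) : cof (𝟙 X) ∧ weq (𝟙 X)
  /-- Cofibrations are closed under composition. -/
  cof_comp {X Y Z : C} (f : X ⟶ Y) (g : Y ⟶ Z) : cof f → cof g → cof (f ≫ g)
  /-- Weak equivalences are closed under composition. -/
  weq_comp {X Y Z : C} (f : X ⟶ Y) (g : Y ⟶ Z) : weq f → weq g → weq (f ≫ g)
  /-- Weak equivalences satisfy 2-out-of-6. -/
  two_out_of_six {X Y Z W : C} (f : X ⟶ Y) (g : Y ⟶ Z) (h : Z ⟶ W) :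
    weq (f ≫ g) → weq (g ≫ h) → weq f ∧ weq g ∧ weq h ∧ weq (f ≫ g ≫ h)
  /-- There is an initial object. -/
  hasInitial : HasInitial C
  /-- Every map out of an initial object is a cofibration. -/
  cofibrant {I : C} (hI : IsInitial I) (X : C) : cof (hI.to X)
  /-- Pushouts along cofibrations exist. -/
  hasPushout {A X B : C} (i : A ⟶ X) (f : A ⟶ B) : cof i → HasPushout i f
  /-- A pushout of a cofibration is a cofibration. -/
  cof_pushout {A X B Y : C} {i : A ⟶ X} {f : A ⟶ B} {g : X ⟶ Y} {j : B ⟶ Y} :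
    IsPushout f i j g → cof i → cof j
  /-- A pushout of an acyclic cofibration is an acyclic cofibration. -/
  acyclic_pushout {A X B Y : C} {i : A ⟶ X} {f : A ⟶ B} {g : X ⟶ Y} {j : B ⟶ Y} :
    IsPushout f i j g → (cof ⊓ weq) i → (cof ⊓ weq) j
  /-- Codiagonal maps `X ⨿ X ⟶ X` factor as a cofibration followed by a weak equivalence,
  for any choice of the coproduct `X ⨿ X`. -/
  codiagonal (X : C) (c : BinaryCofan X X) (hc : IsColimit c) :
    ∃ (Z : C) (i : c.pt ⟶ Z) (p : Z ⟶ X), cof i ∧ weq p ∧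
      i ≫ p = hc.desc (BinaryCofan.mk (𝟙 X) (𝟙 X))
  /-- Small coproducts exist. -/
  hasCoproducts : HasCoproducts.{w} C
  /-- Transfinite sequences of cofibrations, indexed by a nonempty small well-ordered set,
  have colimits. -/
  hasColimit_transfinite (J : Type w) [LinearOrder J] [SuccOrder J] [OrderBot J]
    [WellFoundedLT J] (F : J ⥤ C) [F.IsWellOrderContinuous] :
    (∀ j : J, ¬ IsMax j → cof (F.map (homOfLE (Order.le_succ j)))) → HasColimit F
  /-- A transfinite composite of cofibrations is a cofibration. -/
  cof_transfinite : MorphismProperty.IsStableUnderTransfiniteComposition.{w} cof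
  /-- A transfinite composite of acyclic cofibrations is an acyclic cofibration. -/
  acyclic_transfinite : MorphismProperty.IsStableUnderTransfiniteComposition.{w} (cof ⊓ weq)

/-! ### Directed graphs -/

/-- A directed graph: a set of vertices with a reflexive binary relation. The degenerate
self-edges `x → x` are part of the data, and there is at most one edge from `x` to `y`. -/
structure DiGraph : Type (u + 1) where
  /-- the set of vertices -/
  V : Type u
  /-- `Edge x y` means that there is an edge `x → y` -/
  Edge : V → V → Prop
  /-- every vertex has its degenerate self-edge -/
  refl : ∀ x, Edge x x

namespace DiGraph

/-- A map of directed graphs: a function on vertices preserving the (reflexive) edge relation. -/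
@[ext]
structure Hom (X Y : DiGraph.{u}) : Type u where
  /-- the function on vertices -/
  toFun : X.V → Y.V
  /-- edges are preserved -/
  map_edge : ∀ {x y : X.V}, X.Edge x y → Y.Edge (toFun x) (toFun y)

instance : Category.{u} DiGraph.{u} where
  Hom := Hom
  id X := ⟨fun x => x, fun h => h⟩
  comp f g := ⟨fun x => g.toFun (f.toFun x), fun h => g.map_edge (f.map_edge h)⟩

variable (X : DiGraph.{u})

/-- A path of length `n` in `X`, i.e. a digraph map `I_n ⟶ X` from the linear digraph
`0 → 1 → ⋯ → n` (steps along degenerate edges are allowed). -/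
def IsPath {n : ℕ} (p : Fin (n + 1) → X.V) : Prop :=
  ∀ i : Fin n, X.Edge (p i.castSucc) (p i.succ)

/-- `p` is a path of length `n` from `x` to `y`. -/
def IsPathFromTo {n : ℕ} (p : Fin (n + 1) → X.V) (x y : X.V) : Prop :=
  X.IsPath p ∧ p 0 = x ∧ p (Fin.last n) = y

/-- The vertex `x` admits a path to the vertex `y`. -/
def HasPath (x y : X.V) : Prop :=
  ∃ (n : ℕ) (p : Fin (n + 1) → X.V), X.IsPathFromTo p x y

/-- `p` is a path from `x` to `y` of minimal length among all paths from `x` to `y`. -/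
def IsMinimalPath {n : ℕ} (p : Fin (n + 1) → X.V) (x y : X.V) : Prop :=
  X.IsPathFromTo p x y ∧
    ∀ (m : ℕ) (q : Fin (m + 1) → X.V), X.IsPathFromTo q x y → n ≤ m

/-- The vertex set of `X^A`: the vertices of `X` which admit a path to some vertex of `A`. -/
def pathsTo (A : Set X.V) : Set X.V :=
  {x | ∃ a ∈ A, X.HasPath x a}

/-- `π` is a projecting decomposition of `X` with respect to the induced subgraph on `A`: for
every vertex `x` and every `a ∈ A` admitting a path from `x`, some path of minimal length from
`x` to `a` passes through `π x`. -/
def IsProjectingDecomposition (A : Set X.V) (π : X.pathsTo A → A) : Prop :=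
  ∀ (x : X.pathsTo A) (a : A), X.HasPath x a →
    ∃ (n : ℕ) (p : Fin (n + 1) → X.V), X.IsMinimalPath p x a ∧ ∃ i, p i = π x

/-- `f : A ⟶ X` is an induced subgraph inclusion: it is injective on vertices and reflects
edges, i.e. it identifies `A` with the induced subgraph of `X` on its image. -/
def IsInducedInclusion {A X : DiGraph.{u}} (f : A ⟶ X) : Prop :=
  Function.Injective f.toFun ∧ ∀ a b : A.V, X.Edge (f.toFun a) (f.toFun b) → A.Edge a b

/-- The cofibrations of directed graphs: the induced subgraph inclusions `A ⟶ X` such that there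
are no edges out of `A` and `X` admits a projecting decomposition with respect to `A`. -/
def cofibrations : MorphismProperty DiGraph.{u} := fun A X f =>
  IsInducedInclusion f ∧
  (∀ (a : A.V) (x : X.V), X.Edge (f.toFun a) x → x ∈ Set.range f.toFun) ∧
  ∃ π : X.pathsTo (Set.range f.toFun) → Set.range f.toFun,
    X.IsProjectingDecomposition (Set.range f.toFun) π

/-! ### Path homology -/

section Tuples

variable (R : Type v) [CommRing R] {V W U : Type u}

/-- `K_n`: the free `R`-module on all `(n+1)`-tuples of elements of `V`. -/
abbrev K (V : Type u) (n : ℕ) : Type (max u v) := (Fin (n + 1) → V) →₀ R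

/-- The differential `K_{n+1} → K_n`,
`(v_0, …, v_{n+1}) ↦ ∑ i, (-1)^i (v_0, …, v_{i-1}, v_{i+1}, …, v_{n+1})`. -/
noncomputable def dK (V : Type u) (n : ℕ) : K R V (n + 1) →ₗ[R] K R V n :=
  Finsupp.linearCombination R fun p : Fin (n + 2) → V =>
    ∑ i : Fin (n + 2), (-1 : R) ^ (i : ℕ) • Finsupp.single (fun j => p (i.succAbove j)) (1 : R)

lemma dK_single {n : ℕ} (p : Fin (n + 2) → V) :
    dK R V n (Finsupp.single p 1) = ∑ i : Fin (n + 2),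
      (-1 : R) ^ (i : ℕ) • Finsupp.single (fun j => p (i.succAbove j)) (1 : R) := by
  simp [dK]

/-- Prepending `x` to tuples. -/
noncomputable def coneK (x : V) (n : ℕ) : K R V n →ₗ[R] K R V (n + 1) :=
  Finsupp.lmapDomain R R fun p => Fin.cons x p

lemma dK_coneK (x : V) (n : ℕ) (c : K R V (n + 1)) :
    dK R V (n + 1) (coneK R x (n + 1) c) = c - coneK R x n (dK R V n c) := by
  suffices h : (dK R V (n + 1)).comp (coneK R x (n + 1)) =
      LinearMap.id - (coneK R x n).comp (dK R V n) from LinearMap.congr_fun h c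
  refine Finsupp.lhom_ext' fun p => LinearMap.ext_ring ?_
  simp only [LinearMap.comp_apply, Finsupp.lsingle_apply, LinearMap.sub_apply, LinearMap.id_apply,
    coneK, Finsupp.lmapDomain_apply, Finsupp.mapDomain_single, dK_single]
  rw [Fin.sum_univ_succ]
  simp only [Fin.val_zero, pow_zero, one_smul, Fin.val_succ, pow_succ, mul_neg, mul_one, neg_smul,
    Finset.sum_neg_distrib, Finsupp.mapDomain_finsetSum, Finsupp.mapDomain_smul,
    Finsupp.mapDomain_single, sub_eq_add_neg, Fin.zero_succAbove, Fin.cons_succ]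
  congr 2
  refine Finset.sum_congr rfl fun i _ => ?_
  congr 2
  funext j
  refine Fin.cases ?_ (fun j => ?_) j <;> simp

lemma dK_dK (n : ℕ) (c : K R V (n + 2)) : dK R V n (dK R V (n + 1) c) = 0 := by
  induction n with
  | zero =>
    suffices h : (dK R V 0).comp (dK R V 1) = 0 from LinearMap.congr_fun h c
    refine Finsupp.lhom_ext' fun p => LinearMap.ext_ring ?_
    have e : ∀ (q r : Fin 1 → V), q 0 = r 0 → q = r := fun q r h =>
      funext fun j => by rw [Subsingleton.elim j 0, h]
    have d0 (q : Fin 2 → V) : dK R V 0 (Finsupp.single q 1) =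
        Finsupp.single (fun _ => q 1) 1 - Finsupp.single (fun _ => q 0) 1 := by
      rw [dK_single]
      refine (Fin.sum_univ_two _).trans ?_
      rw [e (fun j => q ((0 : Fin 2).succAbove j)) (fun _ => q 1) rfl,
        e (fun j => q ((1 : Fin 2).succAbove j)) (fun _ => q 0) rfl]
      simp [sub_eq_add_neg]
    simp only [LinearMap.comp_apply, Finsupp.lsingle_apply, LinearMap.zero_apply]
    rw [dK_single]
    refine (congrArg _ (Fin.sum_univ_three _)).trans ?_
    simp only [map_add, map_smul, d0]
    have h1 : p ((0 : Fin 3).succAbove (1 : Fin 2)) = p 2 := rfl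
    have h2 : p ((0 : Fin 3).succAbove (0 : Fin 2)) = p 1 := rfl
    have h3 : p ((1 : Fin 3).succAbove (1 : Fin 2)) = p 2 := rfl
    have h4 : p ((1 : Fin 3).succAbove (0 : Fin 2)) = p 0 := rfl
    have h5 : p ((2 : Fin 3).succAbove (1 : Fin 2)) = p 1 := rfl
    have h6 : p ((2 : Fin 3).succAbove (0 : Fin 2)) = p 0 := rfl
    rw [h1, h2, h3, h4, h5, h6]
    simp
  | succ n ih =>
    suffices h : (dK R V (n + 1)).comp (dK R V (n + 2)) = 0 from LinearMap.congr_fun h c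
    refine Finsupp.lhom_ext' fun p => LinearMap.ext_ring ?_
    have hp : (Finsupp.single p 1 : K R V (n + 3)) =
        coneK R (p 0) (n + 2) (Finsupp.single (Fin.tail p) 1) := by
      simp [coneK]
    simp only [LinearMap.comp_apply, Finsupp.lsingle_apply, LinearMap.zero_apply]
    rw [hp, dK_coneK, map_sub, dK_coneK, ih]
    simp

/-- The degenerate tuples, `v_i = v_{i+1}` for some `i`. -/
def IsDegenerate {n : ℕ} (p : Fin (n + 1) → V) : Prop :=
  ∃ i : Fin n, p i.castSucc = p i.succ

/-- `DK_n`: the submodule of `K_n` generated by the degenerate tuples. -/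
noncomputable def DK (V : Type u) (n : ℕ) : Submodule R (K R V n) :=
  Submodule.span R ((fun p => Finsupp.single p (1 : R)) '' {p | IsDegenerate p})

/-- `C_n = K_n / DK_n`. -/
abbrev C (V : Type u) (n : ℕ) : Type (max u v) := K R V n ⧸ DK R V n

lemma DK_le_comap_dK (V : Type u) (n : ℕ) :
    DK R V (n + 1) ≤ (DK R V n).comap (dK R V n) := by
  refine Submodule.span_le.2 ?_
  rintro _ ⟨p, ⟨k, hk⟩, rfl⟩
  change dK R V n (Finsupp.single p 1) ∈ DK R V n
  have hne : k.castSucc ≠ k.succ := Fin.castSucc_lt_succ.ne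
  -- the two faces omitting `k` and `k + 1` agree
  have heq : (fun j => p (k.castSucc.succAbove j)) = fun j => p (k.succ.succAbove j) := by
    funext j
    rcases lt_trichotomy j k with h | h | h
    · rw [Fin.succAbove_of_castSucc_lt _ _ (by simpa using h),
        Fin.succAbove_of_castSucc_lt _ _ (by
          simp only [Fin.lt_def, Fin.val_castSucc, Fin.val_succ] at h ⊢; omega)]
    · subst h
      rw [Fin.succAbove_castSucc_self, Fin.succAbove_succ_self, hk]
    · rw [Fin.succAbove_of_le_castSucc _ _ (by simpa using h.le),
        Fin.succAbove_of_le_castSucc _ _ (by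
          simp only [Fin.le_def, Fin.lt_def, Fin.val_castSucc, Fin.val_succ] at h ⊢; omega)]
  rw [dK_single, ← Finset.add_sum_erase _ _ (Finset.mem_univ k.castSucc),
    ← Finset.add_sum_erase _ _ (Finset.mem_erase.2 ⟨hne.symm, Finset.mem_univ k.succ⟩),
    heq, ← add_assoc, ← add_smul]
  have h0 : ((-1 : R) ^ (k.castSucc : ℕ) + (-1) ^ (k.succ : ℕ)) = 0 := by
    simp [pow_succ]
  rw [h0, zero_smul, zero_add]
  refine Submodule.sum_mem _ fun i hi => Submodule.smul_mem _ _ (Submodule.subset_span ⟨_, ?_, rfl⟩)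
  have hi1 : (i : ℕ) ≠ k + 1 := fun h => (Finset.mem_erase.1 hi).1 (Fin.ext (by simpa using h))
  have hi2 : (i : ℕ) ≠ k := fun h =>
    (Finset.mem_erase.1 (Finset.mem_erase.1 hi).2).1 (Fin.ext (by simpa using h))
  have hk' := k.2
  have hi' := i.2
  rcases lt_or_ge (i : ℕ) k with h | h
  · refine ⟨⟨k - 1, by omega⟩, ?_⟩
    have a1 : i.succAbove (Fin.castSucc ⟨k - 1, by omega⟩) = k.castSucc := by
      rw [Fin.succAbove_of_le_castSucc _ _ (by simp only [Fin.le_def, Fin.val_castSucc]; omega)]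
      ext; simp only [Fin.val_castSucc, Fin.val_succ]; omega
    have a2 : i.succAbove (Fin.succ ⟨k - 1, by omega⟩) = k.succ := by
      rw [Fin.succAbove_of_le_castSucc _ _ (by
        simp only [Fin.le_def, Fin.val_castSucc, Fin.val_succ]; omega)]
      ext; simp only [Fin.val_succ]; omega
    simpa only [a1, a2] using hk
  · refine ⟨⟨k, by omega⟩, ?_⟩
    have a1 : i.succAbove (Fin.castSucc ⟨k, by omega⟩) = k.castSucc := by
      rw [Fin.succAbove_of_castSucc_lt _ _ (by simp only [Fin.lt_def, Fin.val_castSucc]; omega)]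
      ext; simp only [Fin.val_castSucc]
    have a2 : i.succAbove (Fin.succ ⟨k, by omega⟩) = k.succ := by
      rw [Fin.succAbove_of_castSucc_lt _ _ (by
        simp only [Fin.lt_def, Fin.val_castSucc, Fin.val_succ]; omega)]
      ext; simp only [Fin.val_castSucc, Fin.val_succ]
    simpa only [a1, a2] using hk

/-- The differential `C_{n+1} → C_n` induced by that of `K`. -/
noncomputable def dC (V : Type u) (n : ℕ) : C R V (n + 1) →ₗ[R] C R V n :=
  (DK R V (n + 1)).mapQ (DK R V n) (dK R V n) (DK_le_comap_dK R V n)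

lemma dC_dC (n : ℕ) (c : C R V (n + 2)) : dC R V n (dC R V (n + 1) c) = 0 := by
  induction c using Submodule.Quotient.induction_on with
  | H c => simp [dC, dK_dK]

/-- The map `K_n(V) → K_n(W)` induced by a function `V → W`. -/
noncomputable def mapK (f : V → W) (n : ℕ) : K R V n →ₗ[R] K R W n :=
  Finsupp.lmapDomain R R fun p => f ∘ p

lemma DK_le_comap_mapK (f : V → W) (n : ℕ) :
    DK R V n ≤ (DK R W n).comap (mapK R f n) := by
  refine Submodule.span_le.2 ?_
  rintro _ ⟨p, ⟨k, hk⟩, rfl⟩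
  refine Submodule.subset_span ⟨f ∘ p, ⟨k, congrArg f hk⟩, ?_⟩
  simp [mapK]

/-- The map `C_n(V) → C_n(W)` induced by a function `V → W`. -/
noncomputable def mapC (f : V → W) (n : ℕ) : C R V n →ₗ[R] C R W n :=
  (DK R V n).mapQ (DK R W n) (mapK R f n) (DK_le_comap_mapK R f n)

lemma dC_mapC (f : V → W) (n : ℕ) (c : C R V (n + 1)) :
    dC R W n (mapC R f (n + 1) c) = mapC R f n (dC R V n c) := by
  induction c using Submodule.Quotient.induction_on with
  | H c =>
    have h : (dK R W n).comp (mapK R f (n + 1)) = (mapK R f n).comp (dK R V n) := by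
      refine Finsupp.lhom_ext' fun p => LinearMap.ext_ring ?_
      simp only [LinearMap.comp_apply, Finsupp.lsingle_apply, mapK, Finsupp.lmapDomain_apply,
        Finsupp.mapDomain_single, dK_single, Finsupp.mapDomain_finsetSum, Finsupp.mapDomain_smul]
      rfl
    have h' := LinearMap.congr_fun h c
    simp only [LinearMap.comp_apply] at h'
    simp [dC, mapC, h']

lemma mapC_id (n : ℕ) (c : C R V n) : mapC R (fun x : V => x) n c = c := by
  induction c using Submodule.Quotient.induction_on with
  | H c =>
    have h : mapK R (fun x : V => x) n c = c := Finsupp.mapDomain_id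
    simp [mapC, h]

lemma mapC_comp (f : V → W) (g : W → U) (n : ℕ) (c : C R V n) :
    mapC R (fun x => g (f x)) n c = mapC R g n (mapC R f n c) := by
  induction c using Submodule.Quotient.induction_on with
  | H c =>
    have h : mapK R (fun x => g (f x)) n c = mapK R g n (mapK R f n c) :=
      Finsupp.mapDomain_comp (f := fun p : Fin (n + 1) → V => f ∘ p)
        (g := fun p : Fin (n + 1) → W => g ∘ p)
    simp [mapC, h]

end Tuples

section Omega

variable (R : Type v) [CommRing R]

/-- `A_n(X)`, the module of allowed regular paths, as a submodule of `C_n(X)`: it is generated by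
the classes of the paths of length `n` in `X`. -/
noncomputable def allowed (n : ℕ) : Submodule R (C R X.V n) :=
  Submodule.span R ((fun p => (DK R X.V n).mkQ (Finsupp.single p 1)) '' {p | X.IsPath p})

/-- `Ω_n(X)` as a submodule of `C_n(X)`: `Ω_0 = A_0`, and `Ω_{n+1}` consists of the elements of
`A_{n+1}` whose boundary lies in `A_n`, i.e. it is the pullback of
`∂ : A_{n+1} → C_n` and `A_n ↪ C_n`. -/
noncomputable def Omega : (n : ℕ) → Submodule R (C R X.V n)
  | 0 => X.allowed R 0
  | n + 1 => X.allowed R (n + 1) ⊓ (X.allowed R n).comap (dC R X.V n)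

lemma dC_mem_Omega (n : ℕ) (c : C R X.V (n + 1)) (hc : c ∈ X.Omega R (n + 1)) :
    dC R X.V n c ∈ X.Omega R n := by
  cases n with
  | zero => exact hc.2
  | succ n =>
    refine ⟨hc.2, ?_⟩
    change dC R X.V n (dC R X.V (n + 1) c) ∈ X.allowed R n
    rw [dC_dC]
    exact zero_mem _

/-- The differential `Ω_{n+1}(X) → Ω_n(X)`, the restriction of that of `C`. -/
noncomputable def dOmega (n : ℕ) : X.Omega R (n + 1) →ₗ[R] X.Omega R n :=
  (dC R X.V n).restrict (X.dC_mem_Omega R n)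

/-- The chain complex `Ω(X; R)`. -/
noncomputable def OmegaComplex : ChainComplex (ModuleCat.{max u v} R) ℕ :=
  ChainComplex.of (fun n => ModuleCat.of R (X.Omega R n))
    (fun n => ModuleCat.ofHom (X.dOmega R n))
    (fun n => by
      refine ModuleCat.hom_ext (LinearMap.ext fun c => Subtype.ext ?_)
      exact dC_dC R n c.1)

variable {X} {Y : DiGraph.{u}}

lemma mapC_mem_allowed (f : X ⟶ Y) (n : ℕ) (c : C R X.V n) (hc : c ∈ X.allowed R n) :
    mapC R f.toFun n c ∈ Y.allowed R n := by
  suffices h : X.allowed R n ≤ (Y.allowed R n).comap (mapC R f.toFun n) from h hc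
  refine Submodule.span_le.2 ?_
  rintro _ ⟨p, hp, rfl⟩
  refine Submodule.subset_span ⟨f.toFun ∘ p, fun i => f.map_edge (hp i), ?_⟩
  simp [mapC, mapK]

lemma mapC_mem_Omega (f : X ⟶ Y) (n : ℕ) (c : C R X.V n) (hc : c ∈ X.Omega R n) :
    mapC R f.toFun n c ∈ Y.Omega R n := by
  cases n with
  | zero => exact mapC_mem_allowed R f 0 c hc
  | succ n =>
    refine ⟨mapC_mem_allowed R f _ c hc.1, ?_⟩
    change dC R Y.V n (mapC R f.toFun (n + 1) c) ∈ Y.allowed R n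
    rw [dC_mapC]
    exact mapC_mem_allowed R f n _ hc.2

/-- The map `Ω_n(X) → Ω_n(Y)` induced by a map of digraphs. -/
noncomputable def mapOmega (f : X ⟶ Y) (n : ℕ) : X.Omega R n →ₗ[R] Y.Omega R n :=
  (mapC R f.toFun n).restrict (mapC_mem_Omega R f n)

/-- The functor `Ω : DiGraph ⥤ Ch_R`. -/
noncomputable def OmegaFunctor : DiGraph.{u} ⥤ ChainComplex (ModuleCat.{max u v} R) ℕ where
  obj X := X.OmegaComplex R
  map {X Y} f := ChainComplex.ofHom (X := X.OmegaComplex R) (Y := Y.OmegaComplex R)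
    (fun n => ModuleCat.ofHom (mapOmega R f n))
    (fun n => by
      simp only [OmegaComplex, ChainComplex.of_d]
      refine ModuleCat.hom_ext (LinearMap.ext fun c => Subtype.ext ?_)
      exact dC_mapC R f.toFun n c.1)
  map_id X := by
    ext n c
    exact Subtype.ext (mapC_id R n c.1)
  map_comp f g := by
    ext n c
    exact Subtype.ext (mapC_comp R f.toFun g.toFun n c.1)

/-- Path homology `H_n(-; R)` as a functor: the homology of the complex `Ω(-; R)`. -/
noncomputable def pathHomology (n : ℕ) : DiGraph.{u} ⥤ ModuleCat.{max u v} R :=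
  OmegaFunctor R ⋙ HomologicalComplex.homologyFunctor _ _ n

/-- The `R`-homology isomorphisms: the digraph maps inducing isomorphisms on path homology with
coefficients in `R` in all degrees. -/
def homologyIsos : MorphismProperty DiGraph.{u} := fun _ _ f =>
  ∀ n : ℕ, IsIso ((pathHomology R n).map f)

end Omega

end DiGraph

/-! The substance lies in excision for acyclic cofibrations and in a cylinder; the other axioms come
from describing colimits through vertices and edges, from counting path lengths, and from formal
properties of isomorphisms.

Cofibrations. Degenerate edges allow paths to be padded, so a projecting decomposition amounts to
this: each `x` with a path into `A` has a vertex `w` of `A` such that every path of length `n` from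
`x` into `A` can be replaced by one of length `n` through `w`
(`exists_projectingDecomposition_iff`). Together with the absence of edges out of `A`, this passes
to composites, pushouts and colimits of chains. For colimits of chains, homology adds only that a
chain of `Omega` involves finitely many vertices and so lives at some stage
(`homologyIsos_of_chain`).

Cylinder. The box product of `X` with `0 ← 1 → 2 ← 3 → 4` contains two copies of `X` at its ends.
Maps joined by edges are homologous through prism operators (`homologous_of_edge`), so its
projection to `X` is a weak equivalence.

Excision. An induced inclusion is a weak equivalence exactly when the homology of `X` relative to
`A` vanishes (`IsInducedInclusion.homologyIsos_iff`), so for a pushout `Y = X ∪_A B` the task is to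
move relative acyclicity from `X` to `Y`. Both map to the digraph in which `A`, respectively `B`,
becomes a point `*`. Two facts suffice. (1) Chains of `Omega` in positive degree lift from the
collapsed digraph to `X` (`IsLocalProjection.exists_mapC_collapse_eq`). A nondegenerate path there
either stays outside `A` or reaches `*` in its last step; a chain `v` of paths extended by `*` lifts
to a signed prism from `v` to `π v`, because collapsing leaves a single term of each prism. (2) A
chain of `Omega` in positive degree that dies under collapsing lies in the collapsed part
(`mem_tuplesIn_of_mapC_eq_zero`). A vertex outside has an edge to at most one vertex inside, so a
stray path would have a forbidden face that no other term cancels. Given a relative cycle of `Y`,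
(1) replaces it by a chain of `X` up to a chain in `B`, (2) applied in `X` shows that this chain is
a relative cycle, and acyclicity of `X` finishes (`isRelAcyclic_of_isPushout`). -/

namespace DiGraph

/-! ### Colimits of directed graphs -/

/-- The functor sending a digraph to its set of vertices. -/
def vertices : DiGraph.{u} ⥤ Type u where
  obj X := X.V
  map f := TypeCat.ofHom f.toFun

@[ext]
lemma hom_ext {X Y : DiGraph.{u}} {f g : X ⟶ Y} (h : ∀ x, f.toFun x = g.toFun x) : f = g :=
  Hom.ext (funext h)

section Colimits

variable {J : Type*} [Category J] {F : J ⥤ DiGraph.{u}}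

/-- The digraph structure on a colimit of vertex sets, whose edges are the images of the edges
in the diagram. -/
def colimitGraph {t : Cocone (F ⋙ vertices)} (ht : IsColimit t) : DiGraph.{u} where
  V := t.pt
  Edge y y' := ∃ (j : J) (x x' : (F.obj j).V), (F.obj j).Edge x x' ∧ t.ι.app j x = y ∧
    t.ι.app j x' = y'
  refl y := by
    obtain ⟨j, x, rfl⟩ := Types.jointly_surjective_of_isColimit ht y
    exact ⟨j, x, x, (F.obj j).refl x, rfl, rfl⟩

/-- The cocone with point `colimitGraph`. -/
def colimitGraphCocone {t : Cocone (F ⋙ vertices)} (ht : IsColimit t) : Cocone F where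
  pt := colimitGraph ht
  ι :=
    { app j := ⟨fun x => t.ι.app j x, fun h => ⟨j, _, _, h, rfl, rfl⟩⟩
      naturality i j f := by
        ext x
        exact ConcreteCategory.congr_hom (t.w f) x }

/-- The cocone `colimitGraphCocone` is a colimit. -/
def colimitGraphIsColimit {t : Cocone (F ⋙ vertices)} (ht : IsColimit t) :
    IsColimit (colimitGraphCocone ht) where
  desc s :=
    { toFun := fun y => ht.desc (vertices.mapCocone s) y
      map_edge := by
        rintro _ _ ⟨j, x, x', h, rfl, rfl⟩
        have e (x : (F.obj j).V) : ht.desc (vertices.mapCocone s) (t.ι.app j x) =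
            (s.ι.app j).toFun x := ConcreteCategory.congr_hom (ht.fac (vertices.mapCocone s) j) x
        rw [e, e]
        exact (s.ι.app j).map_edge h }
  fac s j := by
    ext x
    exact ConcreteCategory.congr_hom (ht.fac (vertices.mapCocone s) j) x
  uniq s m hm := by
    ext y
    obtain ⟨j, x, rfl⟩ := Types.jointly_surjective_of_isColimit ht y
    have := congrArg (fun f => Hom.toFun f x) (hm j)
    exact this.trans
      (ConcreteCategory.congr_hom (ht.fac (vertices.mapCocone s) j) x).symm

lemma hasColimit_of_hasColimit_vertices [HasColimit (F ⋙ vertices)] : HasColimit F :=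
  ⟨_, colimitGraphIsColimit (colimit.isColimit (F ⋙ vertices))⟩

instance [HasColimit (F ⋙ vertices)] : PreservesColimit F vertices :=
  preservesColimit_of_preserves_colimit_cocone
    (colimitGraphIsColimit (colimit.isColimit (F ⋙ vertices)))
    (IsColimit.ofIsoColimit (colimit.isColimit (F ⋙ vertices))
      (Cocone.ext (Iso.refl _)))

instance : HasColimitsOfSize.{u, u} DiGraph.{u} where
  has_colimits_of_shape _ _ := ⟨fun _ => hasColimit_of_hasColimit_vertices⟩

/-- Clear for `colimitGraph`, and transported to an arbitrary colimit along the comparison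
isomorphism. -/
lemma exists_edge_of_isColimit [HasColimit (F ⋙ vertices)] {c : Cocone F} (hc : IsColimit c)
    {y y' : c.pt.V} (h : c.pt.Edge y y') :
    ∃ (j : J) (x x' : (F.obj j).V), (F.obj j).Edge x x' ∧ (c.ι.app j).toFun x = y ∧
      (c.ι.app j).toFun x' = y' := by
  let hc' := colimitGraphIsColimit (colimit.isColimit (F ⋙ vertices))
  let e := hc.coconePointUniqueUpToIso hc'
  have he (j : J) (x : (F.obj j).V) :
      e.inv.toFun (((colimitGraphCocone _).ι.app j).toFun x) = (c.ι.app j).toFun x :=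
    congrArg (fun f => Hom.toFun f x) (hc.comp_coconePointUniqueUpToIso_inv hc' j)
  have hinv (y : c.pt.V) : e.inv.toFun (e.hom.toFun y) = y :=
    congrArg (fun f => Hom.toFun f y) e.hom_inv_id
  obtain ⟨j, x, x', hx, h1, h2⟩ := e.hom.map_edge h
  refine ⟨j, x, x', hx, ?_, ?_⟩
  · rw [← he, ← hinv y, ← h1]; rfl
  · rw [← he, ← hinv y', ← h2]; rfl

lemma exists_vertex_of_isColimit [HasColimit (F ⋙ vertices)] {c : Cocone F} (hc : IsColimit c)
    (y : c.pt.V) : ∃ (j : J) (x : (F.obj j).V), (c.ι.app j).toFun x = y :=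
  Types.jointly_surjective_of_isColimit (isColimitOfPreserves vertices hc) y

end Colimits

lemma isEmpty_of_isInitial {I : DiGraph.{u}} (hI : IsInitial I) : IsEmpty I.V :=
  ⟨fun x => ((hI.to ⟨PEmpty, fun _ _ => True, fun _ => trivial⟩).toFun x).elim⟩

/-! ### Vertices and edges of a pushout -/

section Pushout

variable {A X B Y : DiGraph.{u}} {i : A ⟶ X} {f : A ⟶ B} {g : X ⟶ Y} {j : B ⟶ Y}

lemma vertices_isPushout (h : IsPushout i f g j) :
    IsPushout (vertices.map i) (vertices.map f) (vertices.map g) (vertices.map j) :=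
  h.map vertices

lemma pushout_condition (h : IsPushout i f g j) (a : A.V) :
    g.toFun (i.toFun a) = j.toFun (f.toFun a) :=
  congrArg (fun f => Hom.toFun f a) h.w

lemma pushout_vertex (h : IsPushout i f g j) (y : Y.V) :
    y ∈ Set.range j.toFun ∨ ∃ x, x ∉ Set.range i.toFun ∧ g.toFun x = y := by
  rcases Types.eq_or_eq_of_isPushout' (vertices_isPushout h).flip y with ⟨b, hb⟩ | ⟨x, hx, hx'⟩
  · exact Or.inl ⟨b, hb⟩
  · exact Or.inr ⟨x, hx', hx⟩

lemma pushout_edge (h : IsPushout i f g j) {y y' : Y.V} (e : Y.Edge y y') :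
    (∃ b b', B.Edge b b' ∧ j.toFun b = y ∧ j.toFun b' = y') ∨
      ∃ x x', X.Edge x x' ∧ g.toFun x = y ∧ g.toFun x' = y' := by
  obtain ⟨k, x, x', hx, rfl, rfl⟩ := exists_edge_of_isColimit h.isColimit e
  rcases k with _ | _ | _
  -- Edges at the apex of the span give nothing new: they are images of edges of `X` under `i`.
  · have hw (a : A.V) := congrArg (fun f => Hom.toFun f a) (PushoutCocone.condition_zero h.cocone)
    exact Or.inr ⟨_, _, i.map_edge hx, (hw x).symm, (hw x').symm⟩
  · exact Or.inr ⟨x, x', hx, rfl, rfl⟩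
  · exact Or.inl ⟨x, x', hx, rfl, rfl⟩

lemma pushout_eq_iff (h : IsPushout i f g j) (hi : Function.Injective i.toFun) (x : X.V)
    (b : B.V) : g.toFun x = j.toFun b ↔ ∃ a, i.toFun a = x ∧ f.toFun a = b :=
  Types.pushoutCocone_inl_eq_inr_iff_of_isColimit (vertices_isPushout h).isColimit hi x b

lemma pushout_injective (h : IsPushout i f g j) (hi : Function.Injective i.toFun) :
    Function.Injective j.toFun :=
  Types.pushoutCocone_inr_injective_of_isColimit (vertices_isPushout h).isColimit hi

lemma pushout_injOn (h : IsPushout i f g j) {x x' : X.V}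
    (hx : x ∉ Set.range i.toFun) (e : g.toFun x = g.toFun x') : x = x' := by
  classical
  -- Any function into an indiscrete digraph is a map, so `Q` classifies subsets of vertices. The
  -- subset `{x}` of `X` misses `A`, hence glues with the empty subset of `B` to a subset of `Y`
  -- that separates `x` from all other vertices.
  let Q : DiGraph.{u} := ⟨ULift Prop, fun _ _ => True, fun _ => trivial⟩
  let p : X ⟶ Q := ⟨fun z => ⟨z = x⟩, fun _ => trivial⟩
  let q : B ⟶ Q := ⟨fun _ => ⟨False⟩, fun _ => trivial⟩
  have hw : i ≫ p = f ≫ q := by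
    ext a
    exact ⟨fun h => hx ⟨a, h⟩, False.elim⟩
  have hd (z : X.V) : (h.desc p q hw).toFun (g.toFun z) = p.toFun z :=
    congrArg (fun f => Hom.toFun f z) (h.inl_desc p q hw)
  have := congrArg ULift.down ((hd x).symm.trans ((congrArg _ e).trans (hd x')))
  exact (this.mp rfl).symm

end Pushout

/-! ### Reachability and cofibrations -/

section Reach

variable (X : DiGraph.{u})

/-- There is a path of length `n` from `x` to `y`. -/
def Reach : ℕ → X.V → X.V → Prop
  | 0, x, y => x = y
  | n + 1, x, y => ∃ z, X.Edge x z ∧ Reach n z y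

variable {X}

lemma Reach.trans {m n : ℕ} {x y z : X.V} (h : X.Reach m x y) (h' : X.Reach n y z) :
    X.Reach (m + n) x z := by
  induction m generalizing x with
  | zero => obtain rfl : x = y := h; simpa using h'
  | succ m ih =>
    obtain ⟨w, e, hw⟩ := h
    rw [Nat.succ_add]
    exact ⟨w, e, ih hw⟩

lemma reach_refl (n : ℕ) (x : X.V) : X.Reach n x x := by
  induction n with
  | zero => rfl
  | succ n ih => exact ⟨x, X.refl x, ih⟩

/-- Degenerate edges pad a path, so `Reach n` really means distance at most `n`. This is what lets
minimal paths be avoided later. -/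
lemma Reach.mono {m n : ℕ} {x y : X.V} (h : X.Reach m x y) (hmn : m ≤ n) : X.Reach n x y := by
  obtain ⟨k, rfl⟩ := Nat.exists_eq_add_of_le hmn
  exact h.trans (reach_refl k y)

lemma reach_one {x y : X.V} : X.Reach 1 x y ↔ X.Edge x y :=
  ⟨fun ⟨_, e, (h : _ = _)⟩ => h ▸ e, fun e => ⟨y, e, rfl⟩⟩

lemma Reach.map {Y : DiGraph.{u}} (f : X ⟶ Y) {n : ℕ} {x y : X.V} (h : X.Reach n x y) :
    Y.Reach n (f.toFun x) (f.toFun y) := by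
  induction n generalizing x with
  | zero => exact congrArg f.toFun h
  | succ n ih =>
    obtain ⟨w, e, hw⟩ := h
    exact ⟨_, f.map_edge e, ih hw⟩

lemma IsPath.reach {n : ℕ} {p : Fin (n + 1) → X.V} (hp : X.IsPath p) (d i : ℕ) (h : i + d < n + 1) :
    X.Reach d (p ⟨i, by omega⟩) (p ⟨i + d, h⟩) := by
  induction d generalizing i with
  | zero => rfl
  | succ d ih =>
    refine ⟨p ⟨i + 1, by omega⟩, hp ⟨i, by omega⟩, ?_⟩
    have := ih (i + 1) (by omega)
    convert! this using 3
    omega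

lemma IsPathFromTo.reach {n : ℕ} {p : Fin (n + 1) → X.V} {x y : X.V} (hp : X.IsPathFromTo p x y) :
    X.Reach n x y := by
  obtain ⟨h, rfl, rfl⟩ := hp
  convert! h.reach n 0 (by omega) using 2
  ext; simp

lemma Reach.exists_path {n : ℕ} {x y : X.V} (h : X.Reach n x y) :
    ∃ p : Fin (n + 1) → X.V, X.IsPathFromTo p x y := by
  induction n generalizing x with
  | zero =>
    obtain rfl : x = y := h
    exact ⟨fun _ => x, fun i => i.elim0, rfl, rfl⟩
  | succ n ih =>
    obtain ⟨z, e, hz⟩ := h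
    obtain ⟨p, hp, h0, h1⟩ := ih hz
    refine ⟨Fin.cons x p, fun i => ?_, rfl, ?_⟩
    · refine Fin.cases ?_ (fun i => ?_) i
      · simpa [h0] using e
      · rw [← Fin.succ_castSucc, Fin.cons_succ, Fin.cons_succ]; exact hp i
    · rw [← Fin.succ_last, Fin.cons_succ, h1]

lemma Reach.exists_path_through {m n : ℕ} {x y z : X.V} (h : X.Reach m x y) (h' : X.Reach n y z) :
    ∃ p : Fin (m + n + 1) → X.V, X.IsPathFromTo p x z ∧ ∃ i, p i = y := by
  induction m generalizing x with
  | zero =>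
    obtain rfl : x = y := h
    rw [Nat.zero_add]
    obtain ⟨p, hp⟩ := h'.exists_path
    exact ⟨p, hp, 0, hp.2.1⟩
  | succ m ih =>
    obtain ⟨w, e, hw⟩ := h
    obtain ⟨p, ⟨hp, h0, h1⟩, i, hi⟩ := ih hw
    rw [Nat.add_right_comm m 1 n]
    refine ⟨Fin.cons x p, ⟨fun i => ?_, rfl, ?_⟩, i.succ, by simpa using hi⟩
    · refine Fin.cases ?_ (fun i => ?_) i
      · simpa [h0] using e
      · rw [← Fin.succ_castSucc, Fin.cons_succ, Fin.cons_succ]; exact hp i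
    · rw [← Fin.succ_last, Fin.cons_succ, h1]

lemma hasPath_iff {x y : X.V} : X.HasPath x y ↔ ∃ n, X.Reach n x y :=
  ⟨fun ⟨n, _, hp⟩ => ⟨n, hp.reach⟩, fun ⟨n, h⟩ => ⟨n, h.exists_path⟩⟩

end Reach

/-- The vertex `w` of `A` can serve as the projection of `x`: every path from `x` to `A` can be
replaced by one of the same length through `w`. -/
def ProjectsTo (X : DiGraph.{u}) (A : Set X.V) (x w : X.V) : Prop :=
  w ∈ A ∧ ∀ a ∈ A, ∀ n, X.Reach n x a → ∃ i j, i + j = n ∧ X.Reach i x w ∧ X.Reach j w a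

/-- The right side mentions neither minimality nor a chosen function, which makes it the form to
verify and to use. A minimal path through `w` can be padded to any larger length; conversely,
splitting at the least length yields a minimal path. -/
lemma exists_projectingDecomposition_iff (X : DiGraph.{u}) (A : Set X.V) :
    (∃ π : X.pathsTo A → A, X.IsProjectingDecomposition A π) ↔
      ∀ x, ∀ a ∈ A, ∀ n, X.Reach n x a → ∃ w, X.ProjectsTo A x w := by
  constructor
  · rintro ⟨π, hπ⟩ x a ha n h
    refine ⟨π ⟨x, a, ha, hasPath_iff.2 ⟨n, h⟩⟩, (π _).2, fun b hb m hm => ?_⟩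
    obtain ⟨k, p, ⟨hp, hmin⟩, i, hi⟩ := hπ ⟨x, a, ha, hasPath_iff.2 ⟨n, h⟩⟩ ⟨b, hb⟩
      (hasPath_iff.2 ⟨m, hm⟩)
    obtain ⟨q, hq⟩ := hm.exists_path
    have hk := hmin m q hq
    obtain ⟨hp, h0, h1⟩ := hp
    change p 0 = x at h0
    change p _ = b at h1
    have hik := i.2
    rw [← hi]
    -- All the padding goes after `w`: the second part of the minimal path has length `k - i`, and
    -- `k ≤ m`.
    refine ⟨i, m - i, by omega, ?_, ?_⟩
    · have := hp.reach i 0 (by omega)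
      rw [← h0]
      convert! this using 2
      ext; simp
    · have := hp.reach (k - i) i (by omega)
      refine Reach.mono (m := k - i) ?_ (by omega)
      rw [← h1]
      convert! this using 2
      ext
      simp only [Fin.val_last]
      omega
  · intro h
    choose w hw using fun x : X.pathsTo A =>
      h x.1 x.2.choose x.2.choose_spec.1 _ (hasPath_iff.1 x.2.choose_spec.2).choose_spec
    refine ⟨fun x => ⟨w x, (hw x).1⟩, fun x a hxa => ?_⟩
    classical
    have hex := hasPath_iff.1 hxa
    obtain ⟨i, j, hij, h1, h2⟩ := (hw x).2 a a.2 _ (Nat.find_spec hex)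
    obtain ⟨p, hp, hi⟩ := h1.exists_path_through h2
    refine ⟨i + j, p, ⟨hp, fun m q hq => ?_⟩, hi⟩
    rw [hij]
    exact Nat.find_min' hex hq.reach

/-! ### Cofibrations: isomorphisms, composites, initial objects -/

section Cofibration

variable {A X Y : DiGraph.{u}}

lemma cofibrations_iff (f : A ⟶ X) : cofibrations f ↔ IsInducedInclusion f ∧
    (∀ (a : A.V) (x : X.V), X.Edge (f.toFun a) x → x ∈ Set.range f.toFun) ∧
    ∀ x a n, X.Reach n x (f.toFun a) → ∃ w, X.ProjectsTo (Set.range f.toFun) x w := by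
  rw [cofibrations, exists_projectingDecomposition_iff]
  simp only [Set.forall_mem_range]

/-- Without edges out of `A`, a path that starts in `A` never leaves it. -/
lemma exists_reach_of_reach {f : A ⟶ X} (hf : IsInducedInclusion f)
    (hout : ∀ (a : A.V) (x : X.V), X.Edge (f.toFun a) x → x ∈ Set.range f.toFun)
    {n : ℕ} {a : A.V} {y : X.V} (h : X.Reach n (f.toFun a) y) :
    ∃ b, f.toFun b = y ∧ A.Reach n a b := by
  induction n generalizing a with
  | zero => exact ⟨a, h, rfl⟩
  | succ n ih =>
    obtain ⟨z, e, hz⟩ := h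
    obtain ⟨c, rfl⟩ := hout a z e
    obtain ⟨b, hb, hb'⟩ := ih hz
    exact ⟨b, hb, c, hf.2 _ _ e, hb'⟩

lemma reach_of_reach {f : A ⟶ X} (hf : IsInducedInclusion f)
    (hout : ∀ (a : A.V) (x : X.V), X.Edge (f.toFun a) x → x ∈ Set.range f.toFun)
    {n : ℕ} {a b : A.V} (h : X.Reach n (f.toFun a) (f.toFun b)) : A.Reach n a b := by
  obtain ⟨c, hc, h'⟩ := exists_reach_of_reach hf hout h
  rwa [← hf.1 hc]

lemma cofibrations_of_surjective (f : A ⟶ X) (hf : IsInducedInclusion f)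
    (hs : Function.Surjective f.toFun) : cofibrations f := by
  rw [cofibrations_iff]
  exact ⟨hf, fun _ x _ => hs x, fun x a n h =>
    ⟨x, hs x, fun b _ m hm => ⟨0, m, by simp, rfl, hm⟩⟩⟩

lemma cofibrations_of_isIso (f : A ⟶ X) [IsIso f] : cofibrations f := by
  have h1 (a : A.V) : (inv f).toFun (f.toFun a) = a :=
    congrArg (fun f => Hom.toFun f a) (IsIso.hom_inv_id f)
  have h2 (x : X.V) : f.toFun ((inv f).toFun x) = x :=
    congrArg (fun f => Hom.toFun f x) (IsIso.inv_hom_id f)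
  refine cofibrations_of_surjective f ⟨Function.LeftInverse.injective h1, fun a b h => ?_⟩
    (Function.RightInverse.surjective h2)
  simpa only [h1] using (inv f).map_edge h

lemma cofibrations_comp {Z : DiGraph.{u}} (f : A ⟶ X) (g : X ⟶ Z) (hf : cofibrations f)
    (hg : cofibrations g) : cofibrations (f ≫ g) := by
  rw [cofibrations_iff] at *
  obtain ⟨hf, fout, fproj⟩ := hf
  obtain ⟨hg, gout, gproj⟩ := hg
  refine ⟨⟨hg.1.comp hf.1, fun a b h => hf.2 _ _ (hg.2 _ _ h)⟩, fun a z h => ?_, fun z a n h => ?_⟩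
  · obtain ⟨x, rfl⟩ := gout _ _ h
    obtain ⟨b, rfl⟩ := fout _ _ (hg.2 _ _ h)
    exact ⟨b, rfl⟩
  -- Project `z` first to `x` in the middle digraph, then `x` to `c` in `A`. The second projection
  -- exists because the given path may be routed through `x`, and its remainder stays in the middle
  -- digraph.
  · obtain ⟨_, ⟨x, rfl⟩, hx⟩ := gproj z _ n h
    obtain ⟨i, j, -, -, hj⟩ := hx _ ⟨_, rfl⟩ n h
    obtain ⟨_, ⟨c, rfl⟩, hc⟩ := fproj x a j (reach_of_reach hg gout hj)
    refine ⟨g.toFun (f.toFun c), ⟨c, rfl⟩, ?_⟩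
    rintro _ ⟨b, rfl⟩ m hm
    obtain ⟨i, j, rfl, hi, hj⟩ := hx _ ⟨_, rfl⟩ m hm
    obtain ⟨k, l, rfl, hk, hl⟩ := hc _ ⟨b, rfl⟩ j (reach_of_reach hg gout hj)
    exact ⟨i + k, l, by omega, hi.trans (hk.map g), hl.map g⟩

lemma cofibrations_of_isInitial {I : DiGraph.{u}} (hI : IsInitial I) (X : DiGraph.{u}) :
    cofibrations (hI.to X) := by
  have := isEmpty_of_isInitial hI
  rw [cofibrations_iff]
  exact ⟨⟨fun a => isEmptyElim a, fun a => isEmptyElim a⟩, fun a => isEmptyElim a,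
    fun x a => isEmptyElim a⟩

end Cofibration

/-! ### Pushouts of cofibrations -/

section Pushout

variable {A X B Y : DiGraph.{u}} {i : A ⟶ X} {f : A ⟶ B} {g : X ⟶ Y} {j : B ⟶ Y}

lemma pushout_edge_left (h : IsPushout i f g j) (hi : IsInducedInclusion i)
    (hout : ∀ (a : A.V) (x : X.V), X.Edge (i.toFun a) x → x ∈ Set.range i.toFun)
    {b : B.V} {y : Y.V} (e : Y.Edge (j.toFun b) y) : ∃ b', j.toFun b' = y ∧ B.Edge b b' := by
  rcases pushout_edge h e with ⟨c, c', hc, h1, h2⟩ | ⟨x, x', hx, h1, h2⟩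
  · rw [← pushout_injective h hi.1 h1]
    exact ⟨c', h2, hc⟩
  · obtain ⟨a, rfl, rfl⟩ := (pushout_eq_iff h hi.1 x b).1 h1
    obtain ⟨a', rfl⟩ := hout a x' hx
    exact ⟨f.toFun a', by rw [← h2, pushout_condition h], f.map_edge (hi.2 _ _ hx)⟩

lemma pushout_edge_right (h : IsPushout i f g j) (hi : IsInducedInclusion i)
    {x : X.V} (hx : x ∉ Set.range i.toFun) {y : Y.V} (e : Y.Edge (g.toFun x) y) :
    ∃ x', X.Edge x x' ∧ g.toFun x' = y := by
  rcases pushout_edge h e with ⟨c, c', hc, h1, h2⟩ | ⟨z, x', hx', h1, h2⟩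
  · obtain ⟨a, rfl, -⟩ := (pushout_eq_iff h hi.1 x c).1 h1.symm
    exact (hx ⟨a, rfl⟩).elim
  · rw [← pushout_injOn h hx h1.symm] at hx'
    exact ⟨x', hx', h2⟩

lemma pushout_notMem_range (h : IsPushout i f g j) (hi : IsInducedInclusion i)
    {x : X.V} (hx : x ∉ Set.range i.toFun) : g.toFun x ∉ Set.range j.toFun := by
  rintro ⟨b, hb⟩
  obtain ⟨a, rfl, -⟩ := (pushout_eq_iff h hi.1 x b).1 hb.symm
  exact hx ⟨a, rfl⟩

/-- Outside `A` every edge of `Y` lifts to `X`, so a path from `g x` into `B` can be followed in `X`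
until it meets `A`; only the remainder runs in `Y`. -/
lemma exists_reach_of_pushout (h : IsPushout i f g j) (hi : cofibrations i)
    {x : X.V} {b : B.V} {n : ℕ} (hr : Y.Reach n (g.toFun x) (j.toFun b)) :
    ∃ a k l, k + l = n ∧ X.Reach k x (i.toFun a) ∧ Y.Reach l (j.toFun (f.toFun a)) (j.toFun b) := by
  induction n generalizing x with
  | zero =>
    obtain ⟨a, rfl, rfl⟩ := (pushout_eq_iff h hi.1.1 x b).1 hr
    exact ⟨a, 0, 0, rfl, rfl, rfl⟩
  | succ n ih =>
    by_cases hx : x ∈ Set.range i.toFun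
    · obtain ⟨a, rfl⟩ := hx
      exact ⟨a, 0, n + 1, by omega, rfl, by rwa [← pushout_condition h]⟩
    · obtain ⟨y, e, hy⟩ := hr
      obtain ⟨x', e', rfl⟩ := pushout_edge_right h hi.1 hx e
      obtain ⟨a, k, l, rfl, hk, hl⟩ := ih hy
      exact ⟨a, k + 1, l, by omega, ⟨x', e', hk⟩, hl⟩

lemma cofibrations_of_isPushout (h : IsPushout i f g j) (hi : cofibrations i) :
    cofibrations j := by
  have hi' := hi
  rw [cofibrations_iff] at hi' ⊢
  obtain ⟨hi1, hout, hproj⟩ := hi'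
  refine ⟨⟨pushout_injective h hi1.1, fun b b' e => ?_⟩, fun b y e => ?_, fun y b n hr => ?_⟩
  · obtain ⟨c, hc, e'⟩ := pushout_edge_left h hi1 hout e
    rwa [← pushout_injective h hi1.1 hc]
  · obtain ⟨c, hc, -⟩ := pushout_edge_left h hi1 hout e
    exact ⟨c, hc⟩
  · rcases pushout_vertex h y with ⟨c, rfl⟩ | ⟨x, hx, rfl⟩
    · exact ⟨_, ⟨c, rfl⟩, fun b _ m hm => ⟨0, m, by simp, rfl, hm⟩⟩
    · obtain ⟨a, k, l, -, hk, -⟩ := exists_reach_of_pushout h hi hr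
      obtain ⟨_, ⟨c, rfl⟩, hc⟩ := hproj x a k hk
      -- The projection of `g x` is the image of the projection `c` of `x`: any path into `B` enters
      -- through some `a'` in `A`, and its part in `X` can be routed through `c`.
      refine ⟨j.toFun (f.toFun c), ⟨_, rfl⟩, ?_⟩
      rintro _ ⟨b', rfl⟩ m hm
      obtain ⟨a', k, l, rfl, hk, hl⟩ := exists_reach_of_pushout h hi hm
      obtain ⟨p, q, rfl, hp, hq⟩ := hc _ ⟨a', rfl⟩ k hk
      refine ⟨p, q + l, by omega, ?_, ?_⟩
      · have := hp.map g
        rwa [pushout_condition h] at this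
      · have := hq.map g
        rw [pushout_condition h, pushout_condition h] at this
        exact this.trans hl

end Pushout

/-! ### Colimits of chains of cofibrations -/

section Transfinite

variable {J : Type u} [LinearOrder J] {F : J ⥤ DiGraph.{u}} {c : Cocone F}

lemma exists_common_of_isColimit (hc : IsColimit c) (i₀ : J) (s : Finset c.pt.V) :
    ∃ i, i₀ ≤ i ∧ ∀ y ∈ s, y ∈ Set.range (c.ι.app i).toFun := by
  classical
  induction s using Finset.induction_on with
  | empty => exact ⟨i₀, le_rfl, by simp⟩
  | insert y s _ ih =>
    obtain ⟨i, hi, hs⟩ := ih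
    obtain ⟨k, x, rfl⟩ := exists_vertex_of_isColimit hc y
    have hw {l m : J} (h : l ≤ m) (x : (F.obj l).V) :
        (c.ι.app m).toFun ((F.map (homOfLE h)).toFun x) = (c.ι.app l).toFun x :=
      congrArg (fun f => Hom.toFun f x) (c.w (homOfLE h))
    refine ⟨max i k, hi.trans (le_max_left _ _), fun z hz => ?_⟩
    rcases Finset.mem_insert.1 hz with rfl | hz
    · exact ⟨_, hw (le_max_right i k) x⟩
    · obtain ⟨x', rfl⟩ := hs z hz
      exact ⟨_, hw (le_max_left i k) x'⟩

lemma cofibrations_ι_of_isColimit (hc : IsColimit c)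
    (hF : ∀ (i j : J) (h : i ⟶ j), cofibrations (F.map h)) (i : J) :
    cofibrations (c.ι.app i) := by
  have hw {l m : J} (h : l ⟶ m) (x : (F.obj l).V) :
      (c.ι.app m).toFun ((F.map h).toFun x) = (c.ι.app l).toFun x :=
    congrArg (fun f => Hom.toFun f x) (c.w h)
  have : Nonempty J := ⟨i⟩
  have hinj (i : J) : Function.Injective (c.ι.app i).toFun := by
    intro x y hxy
    obtain ⟨j, h, e⟩ := (Types.FilteredColimit.isColimit_eq_iff'
      (isColimitOfPreserves vertices hc) x y).1 hxy
    exact (hF i j h).1.1 e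
  have hedge (i : J) (x : (F.obj i).V) (y : c.pt.V) (e : c.pt.Edge ((c.ι.app i).toFun x) y) :
      ∃ x', (F.obj i).Edge x x' ∧ (c.ι.app i).toFun x' = y := by
    obtain ⟨k, z, z', ez, hz, rfl⟩ := exists_edge_of_isColimit hc e
    have l1 : i ⟶ max i k := homOfLE (le_max_left i k)
    have l2 : k ⟶ max i k := homOfLE (le_max_right i k)
    have e2 := (F.map l2).map_edge ez
    have : (F.map l2).toFun z = (F.map l1).toFun x := hinj _ (by rw [hw, hw, hz])
    rw [this] at e2
    obtain ⟨x', hx'⟩ := (hF _ _ l1).2.1 _ _ e2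
    rw [← hx'] at e2
    exact ⟨x', (hF _ _ l1).1.2 _ _ e2, by rw [← hw l1, hx', hw]⟩
  have hind (i : J) : IsInducedInclusion (c.ι.app i) := ⟨hinj i, fun a b e => by
    obtain ⟨x', e', hx'⟩ := hedge i a _ e
    rwa [← hinj i hx']⟩
  have hout (i : J) (a : (F.obj i).V) (y : c.pt.V) (e : c.pt.Edge ((c.ι.app i).toFun a) y) :
      y ∈ Set.range (c.ι.app i).toFun := by
    obtain ⟨x', -, hx'⟩ := hedge i a _ e
    exact ⟨x', hx'⟩
  rw [cofibrations_iff]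
  refine ⟨hind i, hout i, fun y a n hr => ?_⟩
  obtain ⟨k, hk, hy⟩ := exists_common_of_isColimit hc i {y}
  obtain ⟨x, rfl⟩ := hy y (Finset.mem_singleton_self y)
  have hik := hF i k (homOfLE hk)
  rw [cofibrations_iff] at hik
  -- Paths of the colimit that start at stage `k` stay there, so projecting `y` is a question about
  -- the single cofibration from stage `i` to stage `k`.
  have key {n : ℕ} {a : (F.obj i).V}
      (hr : c.pt.Reach n ((c.ι.app k).toFun x) ((c.ι.app i).toFun a)) :
      (F.obj k).Reach n x ((F.map (homOfLE hk)).toFun a) := by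
    rw [← hw (homOfLE hk)] at hr
    exact reach_of_reach (hind k) (hout k) hr
  obtain ⟨_, ⟨w, rfl⟩, hx⟩ := hik.2.2 x a n (key hr)
  refine ⟨(c.ι.app i).toFun w, ⟨w, rfl⟩, ?_⟩
  rintro _ ⟨b, rfl⟩ m hm
  obtain ⟨p, q, rfl, hp, hq⟩ := hx _ ⟨b, rfl⟩ m (key hm)
  refine ⟨p, q, rfl, ?_, ?_⟩
  · have := hp.map (c.ι.app k)
    rw [hw] at this
    exact this
  · have := hq.map (c.ι.app k)
    rw [hw, hw] at this
    exact this

/-- A class of maps which contains the isomorphisms, and is closed under composition and passing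
to colimits along chains, is closed under transfinite composition. -/
lemma isStableUnderTransfiniteComposition (P : MorphismProperty DiGraph.{u})
    (iso : ∀ {X Y : DiGraph.{u}} (f : X ⟶ Y) [IsIso f], P f)
    (comp : ∀ {X Y Z : DiGraph.{u}} (f : X ⟶ Y) (g : Y ⟶ Z), P f → P g → P (f ≫ g))
    (colim : ∀ (J : Type u) [LinearOrder J] (F : J ⥤ DiGraph.{u}) (c : Cocone F),
      IsColimit c → (∀ (i j : J) (h : i ⟶ j), P (F.map h)) → ∀ i, P (c.ι.app i)) :
    MorphismProperty.IsStableUnderTransfiniteComposition.{u} P where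
  isStableUnderTransfiniteCompositionOfShape J _ _ _ _ := by
    refine ⟨fun X Y f ⟨hf⟩ => ?_⟩
    have hmap (j i : J) (h : i ⟶ j) : P (hf.F.map h) := by
      induction j using SuccOrder.limitRecOn generalizing i with
      | isMin j hj =>
        obtain rfl : i = j := hj.eq_of_le (leOfHom h)
        obtain rfl : h = 𝟙 _ := rfl
        exact iso _
      | succ j hj ih =>
        rcases (leOfHom h).eq_or_lt with rfl | hlt
        · obtain rfl : h = 𝟙 _ := rfl
          exact iso _
        · have hij : i ≤ j := (Order.lt_succ_iff_of_not_isMax hj).1 hlt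
          obtain rfl : h = homOfLE hij ≫ homOfLE (Order.le_succ j) := rfl
          rw [Functor.map_comp]
          exact comp _ _ (ih i _) (hf.map_mem j hj)
      | isSuccLimit j hj ih =>
        rcases (leOfHom h).eq_or_lt with rfl | hlt
        · obtain rfl : h = 𝟙 _ := rfl
          exact iso _
        -- At a limit `j`, `F j` is the colimit over `Iio j`, whose transition maps lie in `P` by
        -- induction.
        · exact colim (Set.Iio j) _ _ (hf.F.isColimitOfIsWellOrderContinuous j hj)
            (fun k l e => ih l.1 l.2 k.1 _) ⟨i, hlt⟩
    rw [← hf.fac]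
    exact comp _ _ (iso _) (colim J hf.F _ hf.isColimit (fun i j h => hmap j i h) ⊥)

end Transfinite

/-! ### Path homology in terms of elements -/

section Homology

variable {R : Type v} [CommRing R]

lemma homologyπ_eq_zero_iff (S : ShortComplex (ModuleCat.{w} R)) (x : S.cycles) :
    S.homologyπ x = 0 ↔ ∃ w : S.X₁, S.f w = S.iCycles x := by
  have hex := ShortComplex.exact_of_g_is_cokernel (ShortComplex.mk S.toCycles S.homologyπ (by simp))
    S.homologyIsCokernel
  have hi : Function.Injective S.iCycles := (ModuleCat.mono_iff_injective _).1 inferInstance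
  have hw (w : S.X₁) : S.iCycles (S.toCycles w) = S.f w :=
    ConcreteCategory.congr_hom S.toCycles_i w
  constructor
  · intro h
    obtain ⟨w, hw'⟩ := (ShortComplex.moduleCat_exact_iff _).1 hex x h
    exact ⟨w, by rw [← hw]; exact congrArg _ hw'⟩
  · rintro ⟨w, hw'⟩
    obtain rfl : S.toCycles w = x := hi (by rw [hw, hw'])
    exact ConcreteCategory.congr_hom S.toCycles_comp_homologyπ w

lemma exists_iCycles_eq (S : ShortComplex (ModuleCat.{w} R)) (x : S.X₂) (hx : S.g x = 0) :
    ∃ z, S.iCycles z = x :=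
  ⟨S.moduleCatCyclesIso.inv ⟨x, hx⟩,
    ConcreteCategory.congr_hom S.moduleCatCyclesIso_inv_iCycles ⟨x, hx⟩⟩

/-- The two conjuncts are injectivity and surjectivity on homology, read off on representing cycles.
-/
lemma isIso_homologyMap_iff {S T : ShortComplex (ModuleCat.{w} R)} (φ : S ⟶ T) :
    IsIso (ShortComplex.homologyMap φ) ↔
      (∀ z, S.g z = 0 → (∃ w, T.f w = φ.τ₂ z) → ∃ w, S.f w = z) ∧
        ∀ y, T.g y = 0 → ∃ z, S.g z = 0 ∧ ∃ w, T.f w = y - φ.τ₂ z := by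
  have hπS : Function.Surjective S.homologyπ := (ModuleCat.epi_iff_surjective _).1 inferInstance
  have hπT : Function.Surjective T.homologyπ := (ModuleCat.epi_iff_surjective _).1 inferInstance
  have hg (S : ShortComplex (ModuleCat.{w} R)) (x : S.cycles) : S.g (S.iCycles x) = 0 :=
    ConcreteCategory.congr_hom S.iCycles_g x
  have hφ (x : S.cycles) : T.iCycles (ShortComplex.cyclesMap φ x) = φ.τ₂ (S.iCycles x) :=
    ConcreteCategory.congr_hom (ShortComplex.cyclesMap_i φ) x
  have hH (x : S.cycles) : ShortComplex.homologyMap φ (S.homologyπ x) =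
      T.homologyπ (ShortComplex.cyclesMap φ x) :=
    ConcreteCategory.congr_hom (ShortComplex.homologyπ_naturality φ) x
  rw [ConcreteCategory.isIso_iff_bijective]
  refine and_congr ⟨fun h z hz hw => ?_, fun h => ?_⟩ ⟨fun h y hy => ?_, fun h y => ?_⟩
  · obtain ⟨x, rfl⟩ := exists_iCycles_eq S z hz
    refine (homologyπ_eq_zero_iff S x).1 (h ?_)
    rw [hH, map_zero]
    refine (homologyπ_eq_zero_iff T _).2 ?_
    rwa [hφ]
  · refine (injective_iff_map_eq_zero (ShortComplex.homologyMap φ).hom).2 fun y hy => ?_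
    obtain ⟨x, rfl⟩ := hπS y
    refine (homologyπ_eq_zero_iff S x).2 (h _ (hg S x) ?_)
    rw [← hφ]
    refine (homologyπ_eq_zero_iff T _).1 ?_
    rw [← hH]
    exact hy
  · obtain ⟨y, rfl⟩ := exists_iCycles_eq T y hy
    obtain ⟨x, hx⟩ := h (T.homologyπ y)
    obtain ⟨x, rfl⟩ := hπS x
    refine ⟨S.iCycles x, hg S x, ?_⟩
    rw [← hφ, ← map_sub]
    refine (homologyπ_eq_zero_iff T _).1 ?_
    rw [map_sub, ← hH, hx, sub_self]
  · obtain ⟨y, rfl⟩ := hπT y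
    obtain ⟨z, hz, hw⟩ := h _ (hg T y)
    obtain ⟨x, rfl⟩ := exists_iCycles_eq S z hz
    refine ⟨S.homologyπ x, ?_⟩
    rw [hH, eq_comm, ← sub_eq_zero, ← map_sub]
    refine (homologyπ_eq_zero_iff T _).2 ?_
    rwa [map_sub, hφ]

variable (R)

/-- The element `c` of `C_n` is a cycle; in degree `0` there is no condition. -/
def IsCycle {V : Type u} : (n : ℕ) → C R V n → Prop
  | 0, _ => True
  | n + 1, c => dC R V n c = 0

lemma OmegaComplex_d_next (X : DiGraph.{u}) (n : ℕ) (c : X.Omega R n) :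
    (X.OmegaComplex R).d n ((ComplexShape.down ℕ).next n) c = 0 ↔ IsCycle R n c.1 := by
  cases n with
  | zero =>
    refine iff_of_true ?_ trivial
    rw [(X.OmegaComplex R).shape _ _ (by simp)]
    rfl
  | succ n =>
    have h : (ComplexShape.down ℕ).next (n + 1) = n := ChainComplex.next_nat_succ n
    rw [h]
    simp only [OmegaComplex, ChainComplex.of_d]
    exact Subtype.ext_iff

lemma OmegaComplex_d_prev (X : DiGraph.{u}) (n : ℕ) (c : X.Omega R n) :
    (∃ w, (X.OmegaComplex R).d ((ComplexShape.down ℕ).prev n) n w = c) ↔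
      ∃ w ∈ X.Omega R (n + 1), dC R X.V n w = c.1 := by
  have h : (ComplexShape.down ℕ).prev n = n + 1 := ChainComplex.prev ℕ n
  rw [h]
  simp only [OmegaComplex, ChainComplex.of_d]
  exact ⟨fun ⟨w, hw⟩ => ⟨w.1, w.2, congrArg Subtype.val hw⟩,
    fun ⟨w, hw, hw'⟩ => ⟨⟨w, hw⟩, Subtype.ext hw'⟩⟩

lemma homologyIsos_iff {X Y : DiGraph.{u}} (f : X ⟶ Y) : homologyIsos R f ↔ ∀ n,
    (∀ z ∈ X.Omega R n, IsCycle R n z →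
      (∃ w ∈ Y.Omega R (n + 1), dC R Y.V n w = mapC R f.toFun n z) →
        ∃ w ∈ X.Omega R (n + 1), dC R X.V n w = z) ∧
    ∀ y ∈ Y.Omega R n, IsCycle R n y → ∃ z ∈ X.Omega R n, IsCycle R n z ∧
      ∃ w ∈ Y.Omega R (n + 1), dC R Y.V n w = y - mapC R f.toFun n z := by
  refine forall_congr' fun n => (isIso_homologyMap_iff
    ((HomologicalComplex.shortComplexFunctor _ _ n).map ((OmegaFunctor R).map f))).trans
      (and_congr ?_ ?_)
  · constructor
    · intro h z hz hc hw
      exact (OmegaComplex_d_prev R X n ⟨z, hz⟩).1 (h ⟨z, hz⟩ ((OmegaComplex_d_next R X n _).2 hc)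
        ((OmegaComplex_d_prev R Y n ⟨_, mapC_mem_Omega R f n z hz⟩).2 hw))
    · intro h z hc hw
      exact (OmegaComplex_d_prev R X n z).2 (h z.1 z.2 ((OmegaComplex_d_next R X n _).1 hc)
        ((OmegaComplex_d_prev R Y n ⟨_, mapC_mem_Omega R f n z.1 z.2⟩).1 hw))
  · constructor
    · intro h y hy hc
      obtain ⟨z, hz, hw⟩ := h ⟨y, hy⟩ ((OmegaComplex_d_next R Y n _).2 hc)
      exact ⟨z.1, z.2, (OmegaComplex_d_next R X n _).1 hz,
        (OmegaComplex_d_prev R Y n ⟨_, sub_mem hy (mapC_mem_Omega R f n z.1 z.2)⟩).1 hw⟩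
    · intro h y hc
      obtain ⟨z, hz, hzc, hw⟩ := h y.1 y.2 ((OmegaComplex_d_next R Y n _).1 hc)
      exact ⟨⟨z, hz⟩, (OmegaComplex_d_next R X n _).2 hzc,
        (OmegaComplex_d_prev R Y n
          ⟨_, Submodule.sub_mem (Y.Omega R n) y.2 (mapC_mem_Omega R f n z hz)⟩).2 hw⟩

/-- Homology isomorphisms satisfy 2-out-of-6. -/
lemma homologyIsos_two_out_of_six {X Y Z W : DiGraph.{u}} (f : X ⟶ Y) (g : Y ⟶ Z) (h : Z ⟶ W)
    (hfg : homologyIsos R (f ≫ g)) (hgh : homologyIsos R (g ≫ h)) :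
    homologyIsos R f ∧ homologyIsos R g ∧ homologyIsos R h ∧ homologyIsos R (f ≫ g ≫ h) := by
  have key (n : ℕ) : IsIso ((pathHomology R n).map f) ∧ IsIso ((pathHomology R n).map g) ∧
      IsIso ((pathHomology R n).map h) := by
    have h1 := hfg n
    have h2 := hgh n
    rw [CategoryTheory.Functor.map_comp] at h1 h2
    -- On homology `g` is the second factor of one isomorphism and the first factor of another, so
    -- it is both epi and mono.
    have : Epi ((pathHomology R n).map g) := epi_of_epi ((pathHomology R n).map f) _
    have : Mono ((pathHomology R n).map g) := mono_of_mono _ ((pathHomology R n).map h)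
    have : IsIso ((pathHomology R n).map g) := isIso_of_mono_of_epi _
    exact ⟨IsIso.of_isIso_comp_right _ ((pathHomology R n).map g), this,
      IsIso.of_isIso_comp_left ((pathHomology R n).map g) _⟩
  refine ⟨fun n => (key n).1, fun n => (key n).2.1, fun n => (key n).2.2, fun n => ?_⟩
  obtain ⟨h1, h2, h3⟩ := key n
  simp only [CategoryTheory.Functor.map_comp]
  infer_instance

end Homology

/-! ### Spans of tuples -/

section Span

variable (R : Type v) [CommRing R] {V W : Type u} {n m : ℕ}

/-- The class of a tuple in `C_n`. -/
noncomputable def tupleClass (p : Fin (n + 1) → V) : C R V n :=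
  (DK R V n).mkQ (Finsupp.single p 1)

/-- The submodule of `C_n` spanned by a set of tuples. -/
noncomputable def tupleSpan (S : Set (Fin (n + 1) → V)) : Submodule R (C R V n) :=
  Submodule.span R (tupleClass R '' S)

variable {R}

lemma tupleClass_of_isDegenerate {p : Fin (n + 1) → V} (hp : IsDegenerate p) :
    tupleClass R p = 0 :=
  (Submodule.Quotient.mk_eq_zero _).2 (Submodule.subset_span ⟨p, hp, rfl⟩)

lemma tupleClass_mem {S : Set (Fin (n + 1) → V)} {p : Fin (n + 1) → V}
    (hp : IsDegenerate p ∨ p ∈ S) : tupleClass R p ∈ tupleSpan R S := by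
  rcases hp with hp | hp
  · rw [tupleClass_of_isDegenerate hp]
    exact zero_mem _
  · exact Submodule.subset_span ⟨p, hp, rfl⟩

lemma tupleSpan_le_iff {S : Set (Fin (n + 1) → V)} {M : Submodule R (C R V n)} :
    tupleSpan R S ≤ M ↔ ∀ p ∈ S, ¬ IsDegenerate p → tupleClass R p ∈ M := by
  rw [tupleSpan, Submodule.span_le, Set.image_subset_iff]
  refine forall₂_congr fun p _ => ⟨fun h _ => h, fun h => ?_⟩
  by_cases hp : IsDegenerate p
  · change tupleClass R p ∈ M
    rw [tupleClass_of_isDegenerate hp]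
    exact zero_mem _
  · exact h hp

lemma tupleSpan_mono {S T : Set (Fin (n + 1) → V)} (h : ∀ p ∈ S, ¬ IsDegenerate p → p ∈ T) :
    tupleSpan R S ≤ tupleSpan R T :=
  tupleSpan_le_iff.2 fun p hp hp' => tupleClass_mem (Or.inr (h p hp hp'))

lemma tupleSpan_empty : tupleSpan R (∅ : Set (Fin (n + 1) → V)) = ⊥ := by
  simp [tupleSpan]

lemma mkQ_mem_tupleSpan {S : Set (Fin (n + 1) → V)} (k : K R V n)
    (h : ∀ p, k p ≠ 0 → p ∈ S) : (DK R V n).mkQ k ∈ tupleSpan R S := by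
  rw [← Finsupp.sum_single k, Finsupp.sum, map_sum]
  refine Submodule.sum_mem _ fun p hp => ?_
  have : Finsupp.single p (k p) = k p • Finsupp.single p (1 : R) := by simp
  rw [this, map_smul]
  exact Submodule.smul_mem _ _ (tupleClass_mem (Or.inr (h p (Finsupp.mem_support_iff.1 hp))))

lemma tupleSpan_univ : tupleSpan R (Set.univ : Set (Fin (n + 1) → V)) = ⊤ := by
  refine eq_top_iff.2 fun c _ => ?_
  obtain ⟨k, rfl⟩ := (DK R V n).mkQ_surjective c
  exact mkQ_mem_tupleSpan k fun _ _ => trivial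

lemma tupleSpan_union (S T : Set (Fin (n + 1) → V)) :
    tupleSpan R (S ∪ T) = tupleSpan R S ⊔ tupleSpan R T := by
  rw [tupleSpan, Set.image_union, Submodule.span_union]
  rfl

lemma linearMap_ext {M : Type*} [AddCommGroup M] [Module R M] {f g : C R V n →ₗ[R] M}
    (h : ∀ p, f (tupleClass R p) = g (tupleClass R p)) : f = g := by
  refine LinearMap.ext fun c => ?_
  have : tupleSpan R Set.univ ≤ LinearMap.eqLocus f g := tupleSpan_le_iff.2 fun p _ _ => h p
  exact this (tupleSpan_univ (R := R) (V := V) (n := n) ▸ Submodule.mem_top)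

lemma dC_mkQ (k : K R V (n + 1)) :
    dC R V n ((DK R V (n + 1)).mkQ k) = (DK R V n).mkQ (dK R V n k) := rfl

lemma dC_tupleClass (p : Fin (n + 2) → V) : dC R V n (tupleClass R p) =
    ∑ i : Fin (n + 2), (-1 : R) ^ (i : ℕ) • tupleClass R (fun j => p (i.succAbove j)) := by
  rw [tupleClass, dC_mkQ, dK_single, map_sum]
  simp only [map_smul]
  rfl

/-! ### Coefficients with respect to nondegenerate tuples -/

section Coeff

variable (R) in
open scoped Classical in
/-- The coefficients of an element of `C_n` with respect to the nondegenerate tuples. -/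
noncomputable def coeff (V : Type u) (n : ℕ) : C R V n →ₗ[R] K R V n :=
  (DK R V n).liftQ (Finsupp.linearCombination R
    fun p => if IsDegenerate p then 0 else Finsupp.single p (1 : R)) (by
      refine Submodule.span_le.2 ?_
      rintro _ ⟨p, hp : IsDegenerate p, rfl⟩
      change Finsupp.linearCombination _ _ _ = 0
      simp [hp])

lemma coeff_tupleClass {p : Fin (n + 1) → V} (hp : ¬ IsDegenerate p) :
    coeff R V n (tupleClass R p) = Finsupp.single p 1 := by
  classical
  change Finsupp.linearCombination R _ (Finsupp.single p 1) = _
  rw [Finsupp.linearCombination_single, if_neg hp, one_smul]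

lemma mkQ_coeff (c : C R V n) : (DK R V n).mkQ (coeff R V n c) = c := by
  suffices h : (DK R V n).mkQ.comp (coeff R V n) = LinearMap.id from LinearMap.congr_fun h c
  refine linearMap_ext fun p => ?_
  by_cases hp : IsDegenerate p
  · simp [tupleClass_of_isDegenerate hp]
  · rw [LinearMap.comp_apply, coeff_tupleClass hp]
    rfl

lemma coeff_injective : Function.Injective (coeff R V n) :=
  Function.LeftInverse.injective mkQ_coeff

lemma coeff_mkQ_apply (k : K R V n) {p : Fin (n + 1) → V} (hp : ¬ IsDegenerate p) :
    coeff R V n ((DK R V n).mkQ k) p = k p := by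
  classical
  suffices h : (Finsupp.lapply p).comp ((coeff R V n).comp (DK R V n).mkQ) =
      (Finsupp.lapply p : K R V n →ₗ[R] R) from LinearMap.congr_fun h k
  refine Finsupp.lhom_ext' fun q => LinearMap.ext_ring ?_
  simp only [LinearMap.comp_apply, Finsupp.lsingle_apply, Finsupp.lapply_apply]
  change coeff R V n (tupleClass R q) p = _
  by_cases hq : IsDegenerate q
  · rw [tupleClass_of_isDegenerate hq, map_zero, Finsupp.single_apply, if_neg]
    · rfl
    · rintro rfl
      exact hp hq
  · rw [coeff_tupleClass hq]

/-- `C_n` is free on the nondegenerate tuples, so membership in a span of tuples is a condition on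
supports. Arguments about allowed chains reduce to this. -/
lemma mem_tupleSpan_iff {S : Set (Fin (n + 1) → V)} {c : C R V n} :
    c ∈ tupleSpan R S ↔ ∀ p, coeff R V n c p ≠ 0 → p ∈ S := by
  constructor
  · intro hc p hp
    classical
    by_contra hpS
    have : tupleSpan R S ≤ LinearMap.ker ((Finsupp.lapply p).comp (coeff R V n)) :=
      tupleSpan_le_iff.2 fun q hq hq' => by
        rw [LinearMap.mem_ker, LinearMap.comp_apply, coeff_tupleClass hq', Finsupp.lapply_apply,
          Finsupp.single_apply, if_neg]
        rintro rfl
        exact hpS hq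
    exact hp (this hc)
  · intro h
    rw [← mkQ_coeff c]
    exact mkQ_mem_tupleSpan _ h

lemma not_isDegenerate_of_coeff_ne_zero {c : C R V n} {p : Fin (n + 1) → V}
    (h : coeff R V n c p ≠ 0) : ¬ IsDegenerate p := by
  have : tupleSpan R Set.univ ≤ tupleSpan R {p : Fin (n + 1) → V | ¬ IsDegenerate p} :=
    tupleSpan_mono fun _ _ h => h
  exact mem_tupleSpan_iff.1 (this (tupleSpan_univ (R := R) (V := V) (n := n) ▸ Submodule.mem_top))
    p h

/-- Summands with disjoint supports cannot cancel. -/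
lemma mem_tupleSpan_of_add {S P Q : Set (Fin (n + 1) → V)} (hPQ : Disjoint P Q) {a b : C R V n}
    (ha : a ∈ tupleSpan R P) (hb : b ∈ tupleSpan R Q) (h : a + b ∈ tupleSpan R S) :
    a ∈ tupleSpan R S := by
  rw [mem_tupleSpan_iff] at *
  intro p hp
  have hbp : coeff R V n b p = 0 := by
    by_contra hbp
    exact Set.disjoint_left.1 hPQ (ha p hp) (hb p hbp)
  exact h p (by rwa [map_add, Finsupp.add_apply, hbp, add_zero])

-- Used to isolate the coefficient of one face and count which terms contribute to it.
open scoped Classical in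
lemma coeff_dC {c : C R V (n + 1)} {q : Fin (n + 1) → V} (hq : ¬ IsDegenerate q) :
    coeff R V n (dC R V n c) q = ∑ t ∈ (coeff R V (n + 1) c).support, coeff R V (n + 1) c t *
      ∑ i : Fin (n + 2), if (fun j => t (i.succAbove j)) = q then (-1 : R) ^ (i : ℕ) else 0 := by
  conv_lhs => rw [← mkQ_coeff c, dC_mkQ, coeff_mkQ_apply _ hq, dK, Finsupp.linearCombination_apply,
    Finsupp.sum, Finsupp.finsetSum_apply]
  refine Finset.sum_congr rfl fun t _ => ?_
  rw [Finsupp.smul_apply, smul_eq_mul, Finsupp.finsetSum_apply]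
  congr 1
  refine Finset.sum_congr rfl fun i _ => ?_
  rw [Finsupp.smul_apply, Finsupp.single_apply, smul_eq_mul, mul_ite, mul_one, mul_zero]

end Coeff

/-! ### Linear maps induced by functions on tuples -/

section Map

/-- The linear map induced by a function on tuples which preserves degeneracy. -/
noncomputable def mapTuple (φ : (Fin (n + 1) → V) → (Fin (m + 1) → W))
    (hφ : ∀ p, IsDegenerate p → IsDegenerate (φ p)) : C R V n →ₗ[R] C R W m :=
  (DK R V n).mapQ (DK R W m) (Finsupp.lmapDomain R R φ) (by
    refine Submodule.span_le.2 ?_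
    rintro _ ⟨p, hp, rfl⟩
    refine Submodule.subset_span ⟨φ p, hφ p hp, ?_⟩
    simp)

variable {φ : (Fin (n + 1) → V) → (Fin (m + 1) → W)}
  {hφ : ∀ p, IsDegenerate p → IsDegenerate (φ p)}

lemma mapTuple_tupleClass (p : Fin (n + 1) → V) :
    mapTuple (R := R) φ hφ (tupleClass R p) = tupleClass R (φ p) := by
  change (DK R W m).mkQ (Finsupp.mapDomain φ (Finsupp.single p 1)) = _
  rw [Finsupp.mapDomain_single]
  rfl

lemma isDegenerate_comp (f : V → W) (p : Fin (n + 1) → V) (hp : IsDegenerate p) :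
    IsDegenerate (f ∘ p) := by
  obtain ⟨k, hk⟩ := hp
  exact ⟨k, congrArg f hk⟩

lemma mapC_tupleClass (f : V → W) (p : Fin (n + 1) → V) :
    mapC R f n (tupleClass R p) = tupleClass R (f ∘ p) :=
  mapTuple_tupleClass (hφ := isDegenerate_comp f) p

lemma mapTuple_mem {S : Set (Fin (n + 1) → V)} {T : Set (Fin (m + 1) → W)}
    (h : ∀ p ∈ S, ¬ IsDegenerate p → IsDegenerate (φ p) ∨ φ p ∈ T) {c : C R V n}
    (hc : c ∈ tupleSpan R S) : mapTuple φ hφ c ∈ tupleSpan R T := by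
  have : tupleSpan R S ≤ (tupleSpan R T).comap (mapTuple φ hφ) :=
    tupleSpan_le_iff.2 fun p hp hp' => by
      rw [Submodule.mem_comap, mapTuple_tupleClass]
      exact tupleClass_mem (h p hp hp')
  exact this hc

lemma mapC_mem (f : V → W) {S : Set (Fin (n + 1) → V)} {T : Set (Fin (n + 1) → W)}
    (h : ∀ p ∈ S, ¬ IsDegenerate p → IsDegenerate (f ∘ p) ∨ f ∘ p ∈ T) {c : C R V n}
    (hc : c ∈ tupleSpan R S) : mapC R f n c ∈ tupleSpan R T :=
  mapTuple_mem (hφ := isDegenerate_comp f) h hc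

lemma exists_mapTuple_eq {S : Set (Fin (n + 1) → V)} {T : Set (Fin (m + 1) → W)}
    (h : ∀ q ∈ T, ¬ IsDegenerate q → ∃ p ∈ S, φ p = q) {c : C R W m} (hc : c ∈ tupleSpan R T) :
    ∃ b ∈ tupleSpan R S, mapTuple φ hφ b = c := by
  have : tupleSpan R T ≤ (tupleSpan R S).map (mapTuple φ hφ) :=
    tupleSpan_le_iff.2 fun q hq hq' => by
      obtain ⟨p, hp, rfl⟩ := h q hq hq'
      exact ⟨tupleClass R p, tupleClass_mem (Or.inr hp), mapTuple_tupleClass p⟩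
  exact this hc

lemma coeff_mapTuple (hφ' : ∀ p, IsDegenerate (φ p) → IsDegenerate p) (c : C R V n) :
    coeff R W m (mapTuple φ hφ c) = Finsupp.mapDomain φ (coeff R V n c) := by
  suffices h : (coeff R W m).comp (mapTuple φ hφ) = (Finsupp.lmapDomain R R φ).comp (coeff R V n)
    from LinearMap.congr_fun h c
  refine linearMap_ext fun p => ?_
  simp only [LinearMap.comp_apply, mapTuple_tupleClass]
  by_cases hp : IsDegenerate p
  · rw [tupleClass_of_isDegenerate hp, tupleClass_of_isDegenerate (hφ p hp)]
    simp
  · rw [coeff_tupleClass hp, coeff_tupleClass (fun h => hp (hφ' p h))]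
    simp

lemma mapTuple_injective (hφ' : ∀ p, IsDegenerate (φ p) → IsDegenerate p)
    (hinj : Function.Injective φ) : Function.Injective (mapTuple (R := R) φ hφ) := by
  intro c c' h
  have := congrArg (coeff R W m) h
  rw [coeff_mapTuple hφ', coeff_mapTuple hφ'] at this
  exact coeff_injective (Finsupp.mapDomain_injective hinj this)

lemma mem_tupleSpan_of_mapTuple (hφ' : ∀ p, IsDegenerate (φ p) → IsDegenerate p)
    (hinj : Function.Injective φ) {T : Set (Fin (m + 1) → W)} {c : C R V n}
    (hc : mapTuple φ hφ c ∈ tupleSpan R T) : c ∈ tupleSpan R (φ ⁻¹' T) := by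
  rw [mem_tupleSpan_iff] at *
  intro p hp
  refine hc _ ?_
  rwa [coeff_mapTuple hφ', Finsupp.mapDomain_apply hinj]

lemma isDegenerate_of_comp {f : V → W} (hf : Function.Injective f) {p : Fin (n + 1) → V}
    (h : IsDegenerate (f ∘ p)) : IsDegenerate p := by
  obtain ⟨k, hk⟩ := h
  exact ⟨k, hf hk⟩

lemma mapC_injective {f : V → W} (hf : Function.Injective f) (n : ℕ) :
    Function.Injective (mapC R f n) :=
  mapTuple_injective (hφ := isDegenerate_comp f) (fun _ => isDegenerate_of_comp hf) fun _ _ h =>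
    funext fun k => hf (congrFun h k)

lemma mem_tupleSpan_of_mapC {f : V → W} (hf : Function.Injective f)
    {T : Set (Fin (n + 1) → W)} {c : C R V n} (hc : mapC R f n c ∈ tupleSpan R T) :
    c ∈ tupleSpan R {p | f ∘ p ∈ T} :=
  mem_tupleSpan_of_mapTuple (hφ := isDegenerate_comp f) (fun _ => isDegenerate_of_comp hf)
    (fun _ _ h => funext fun k => hf (congrFun h k)) hc

end Map

end Span

/-! ### The complex of a subgraph -/

section Subgraph

variable {R : Type v} [CommRing R] {A X Y : DiGraph.{u}} {n : ℕ}

/-- The tuples with all entries in `S`. -/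
def tuplesIn {V : Type u} (S : Set V) (n : ℕ) : Set (Fin (n + 1) → V) := {p | ∀ k, p k ∈ S}

lemma allowed_eq_tupleSpan (X : DiGraph.{u}) : X.allowed R n = tupleSpan R {p | X.IsPath p} := rfl

lemma Omega_le_allowed (X : DiGraph.{u}) : X.Omega R n ≤ X.allowed R n := by
  cases n with
  | zero => exact le_rfl
  | succ n => exact inf_le_left

lemma allowed_zero (X : DiGraph.{u}) : X.allowed R 0 = ⊤ := by
  rw [allowed_eq_tupleSpan, ← tupleSpan_univ]
  congr
  exact Set.eq_univ_of_forall fun p i => i.elim0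

lemma Omega_zero (X : DiGraph.{u}) : X.Omega R 0 = ⊤ := allowed_zero X

lemma dC_mem_allowed {X : DiGraph.{u}} {c : C R X.V (n + 1)} (hc : c ∈ X.Omega R (n + 1)) :
    dC R X.V n c ∈ X.allowed R n := hc.2

lemma mapC_mem_tuplesIn_range (f : X.V → Y.V) (c : C R X.V n) :
    mapC R f n c ∈ tupleSpan R (tuplesIn (Set.range f) n) := by
  have hc : c ∈ tupleSpan R Set.univ := by rw [tupleSpan_univ]; trivial
  exact mapC_mem f (fun p _ _ => Or.inr fun k => ⟨p k, rfl⟩) hc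

lemma IsInducedInclusion.mem_allowed {i : A ⟶ X} (hi : IsInducedInclusion i) {c : C R A.V n}
    (hc : mapC R i.toFun n c ∈ X.allowed R n) : c ∈ A.allowed R n := by
  rw [allowed_eq_tupleSpan] at hc ⊢
  have h := mem_tupleSpan_of_mapC hi.1 hc
  refine tupleSpan_mono ?_ h
  intro p hp _ k
  exact hi.2 _ _ (hp k)

lemma IsInducedInclusion.mem_Omega {i : A ⟶ X} (hi : IsInducedInclusion i) {c : C R A.V n}
    (hc : mapC R i.toFun n c ∈ X.Omega R n) : c ∈ A.Omega R n := by
  cases n with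
  | zero => exact hi.mem_allowed hc
  | succ n =>
    refine ⟨hi.mem_allowed hc.1, hi.mem_allowed ?_⟩
    rw [← dC_mapC]
    exact hc.2

/-- `Ω(A)` is the part of `Ω(X)` supported on `A`: since `A` is induced, being allowed may be tested
in `X`, both for a chain and for its boundary. This makes relative homology available without
forming quotients. -/
lemma IsInducedInclusion.exists_mem_Omega {i : A ⟶ X} (hi : IsInducedInclusion i)
    {c : C R X.V n} (hc : c ∈ X.Omega R n)
    (hc' : c ∈ tupleSpan R (tuplesIn (Set.range i.toFun) n)) :
    ∃ b ∈ A.Omega R n, mapC R i.toFun n b = c := by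
  obtain ⟨b, -, rfl⟩ := exists_mapTuple_eq (φ := fun p => i.toFun ∘ p) (S := Set.univ)
    (hφ := isDegenerate_comp i.toFun)
    (fun q hq _ => by
      choose p hp using hq
      exact ⟨p, trivial, funext hp⟩) hc'
  exact ⟨b, hi.mem_Omega hc, rfl⟩

/-- The element `c` is a cycle relative to the set of vertices `S`. -/
def IsRelCycle {V : Type u} (S : Set V) : (n : ℕ) → C R V n → Prop
  | 0, _ => True
  | n + 1, c => dC R V n c ∈ tupleSpan R (tuplesIn S n)

variable (R) in
/-- The homology of `Ω(X)` relative to the set of vertices `S` vanishes. -/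
def IsRelAcyclic (X : DiGraph.{u}) (S : Set X.V) : Prop :=
  ∀ n, ∀ c ∈ X.Omega R n, IsRelCycle S n c →
    ∃ w ∈ X.Omega R (n + 1), c - dC R X.V n w ∈ tupleSpan R (tuplesIn S n)

lemma isCycle_mapC_iff {f : X ⟶ Y} (hf : Function.Injective f.toFun) {c : C R X.V n} :
    IsCycle R n (mapC R f.toFun n c) ↔ IsCycle R n c := by
  cases n with
  | zero => exact Iff.rfl
  | succ n =>
    change dC R Y.V n _ = 0 ↔ dC R X.V n c = 0
    rw [dC_mapC, map_eq_zero_iff _ (mapC_injective hf n)]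

lemma IsCycle.isRelCycle {V : Type u} {c : C R V n} (hc : IsCycle R n c) (S : Set V) :
    IsRelCycle S n c := by
  cases n with
  | zero => trivial
  | succ n =>
    change dC R V n c = 0 at hc
    change dC R V n c ∈ _
    rw [hc]
    exact zero_mem _

lemma isCycle_dC {V : Type u} (c : C R V (n + 1)) : IsCycle R n (dC R V n c) := by
  cases n with
  | zero => trivial
  | succ n => exact dC_dC R n c

lemma IsCycle.sub {V : Type u} {c c' : C R V n} (hc : IsCycle R n c) (hc' : IsCycle R n c') :
    IsCycle R n (c - c') := by
  cases n with
  | zero => trivial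
  | succ n =>
    change dC R V n _ = 0 at *
    rw [map_sub, hc, hc', sub_zero]

/-- An induced subgraph inclusion is a homology isomorphism if and only if the relative homology
vanishes. -/
lemma IsInducedInclusion.homologyIsos_iff {i : A ⟶ X} (hi : IsInducedInclusion i) :
    homologyIsos R i ↔ IsRelAcyclic R X (Set.range i.toFun) := by
  rw [DiGraph.homologyIsos_iff]
  constructor
  · intro h n c hc hrel
    -- Correct a relative cycle to a genuine one: its boundary is a cycle in `A` that bounds in `X`,
    -- so by injectivity it bounds in `A`.
    have main : ∃ a ∈ A.Omega R n, IsCycle R n (c - mapC R i.toFun n a) := by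
      cases n with
      | zero => exact ⟨0, zero_mem _, trivial⟩
      | succ n =>
        obtain ⟨b, hb, hb'⟩ := hi.exists_mem_Omega (X.dC_mem_Omega R n c hc) hrel
        obtain ⟨a, ha, rfl⟩ := (h n).1 b hb ((isCycle_mapC_iff hi.1).1 (hb' ▸ isCycle_dC c))
          ⟨c, hc, hb'.symm⟩
        refine ⟨a, ha, ?_⟩
        change dC R X.V n _ = 0
        rw [map_sub, dC_mapC, hb', sub_self]
    obtain ⟨a, ha, hcyc⟩ := main
    obtain ⟨z, -, -, w, hw, hw'⟩ :=
      (h n).2 _ (sub_mem hc (mapC_mem_Omega R i n a ha)) hcyc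
    refine ⟨w, hw, ?_⟩
    have e : c - dC R X.V n w = mapC R i.toFun n (a + z) := by
      rw [hw', map_add]; abel
    rw [e]
    exact mapC_mem_tuplesIn_range _ _
  · intro h n
    refine ⟨fun z hz hcyc ⟨w, hw, hw'⟩ => ?_, fun y hy hcyc => ?_⟩
    -- The chain `w` is itself a relative cycle, one degree up; subtracting a boundary moves it into
    -- `A` without changing `∂w`.
    · obtain ⟨t, ht, ht'⟩ := h (n + 1) w hw (by
        change dC R X.V n w ∈ _
        rw [hw']
        exact mapC_mem_tuplesIn_range _ _)
      obtain ⟨a, ha, ha'⟩ := hi.exists_mem_Omega (sub_mem hw (X.dC_mem_Omega R _ t ht)) ht'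
      refine ⟨a, ha, mapC_injective hi.1 n ?_⟩
      rw [← dC_mapC, ha', map_sub, dC_dC, sub_zero, hw']
    · obtain ⟨w, hw, hw'⟩ := h n y hy (hcyc.isRelCycle _)
      obtain ⟨a, ha, ha'⟩ := hi.exists_mem_Omega (sub_mem hy (X.dC_mem_Omega R _ w hw)) hw'
      refine ⟨a, ha, (isCycle_mapC_iff hi.1).1 ?_, w, hw, ?_⟩
      · rw [ha']
        exact hcyc.sub (isCycle_dC w)
      · rw [ha']; abel

end Subgraph

/-! ### Homology and colimits of chains -/

section Transfinite

variable {R : Type v} [CommRing R] {J : Type u} [LinearOrder J]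

lemma homologyIsos_of_chain {G : J → DiGraph.{u}} {Y : DiGraph.{u}} (F : ∀ i j, i ≤ j → (G i ⟶ G j))
    (ι : ∀ i, G i ⟶ Y) (hι : ∀ i, IsInducedInclusion (ι i)) (hF : ∀ i j h, F i j h ≫ ι j = ι i)
    (hY : ∀ i₀ (s : Finset Y.V), ∃ i, i₀ ≤ i ∧ ∀ y ∈ s, y ∈ Set.range (ι i).toFun)
    (hF' : ∀ i j h, homologyIsos R (F i j h)) (i : J) : homologyIsos R (ι i) := by
  classical
  have hw {l m : J} (h : l ≤ m) {n : ℕ} (z : C R (G l).V n) :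
      mapC R (ι m).toFun n (mapC R (F l m h).toFun n z) = mapC R (ι l).toFun n z := by
    rw [← mapC_comp, ← hF l m h]
    rfl
  have lift {n : ℕ} (x : C R Y.V n) (hx : x ∈ Y.Omega R n) :
      ∃ k, i ≤ k ∧ ∃ b ∈ (G k).Omega R n, mapC R (ι k).toFun n b = x := by
    -- The finite set consists of all vertices occurring in the tuples of `x`.
    obtain ⟨k, hk, hs⟩ := hY i ((coeff R Y.V n x).support.biUnion fun p => Finset.univ.image p)
    refine ⟨k, hk, (hι k).exists_mem_Omega hx (mem_tupleSpan_iff.2 fun p hp k => hs _ ?_)⟩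
    exact Finset.mem_biUnion.2 ⟨p, Finsupp.mem_support_iff.2 hp,
      Finset.mem_image_of_mem _ (Finset.mem_univ k)⟩
  rw [homologyIsos_iff]
  refine fun n => ⟨fun z hz hcyc ⟨w, hw', hwz⟩ => ?_, fun y hy hcyc => ?_⟩
  · obtain ⟨k, hk, b, hb, rfl⟩ := lift w hw'
    refine (((homologyIsos_iff R _).1 (hF' i k hk)) n).1 z hz hcyc ⟨b, hb, ?_⟩
    refine mapC_injective (hι k).1 n ?_
    rw [hw hk, ← hwz, dC_mapC]
  · obtain ⟨k, hk, b, hb, rfl⟩ := lift y hy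
    obtain ⟨z, hz, hzc, w, hw', hwz⟩ := (((homologyIsos_iff R _).1 (hF' i k hk)) n).2 b hb
      ((isCycle_mapC_iff (hι k).1).1 hcyc)
    refine ⟨z, hz, hzc, mapC R (ι k).toFun _ w, mapC_mem_Omega R (ι k) _ w hw', ?_⟩
    rw [dC_mapC, hwz, map_sub, hw hk]

lemma homologyIsos_ι_of_isColimit {F : J ⥤ DiGraph.{u}} {c : Cocone F} (hc : IsColimit c)
    (hF : ∀ (i j : J) (h : i ⟶ j), cofibrations (F.map h))
    (hF' : ∀ (i j : J) (h : i ⟶ j), homologyIsos R (F.map h)) (i : J) :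
    homologyIsos R (c.ι.app i) :=
  homologyIsos_of_chain (fun _ _ h => F.map (homOfLE h)) c.ι.app
    (fun i => (cofibrations_ι_of_isColimit hc hF i).1) (fun _ _ h => c.w (homOfLE h))
    (exists_common_of_isColimit hc) (fun _ _ _ => hF' _ _ _) i

end Transfinite

/-! ### Prism operators -/

section Prism

variable (R : Type v) [CommRing R] {V W : Type u}

/-- The prism on a tuple `(x_0, …, x_n)` with bottom `f` and top `g`, i.e. the alternating sum of
the tuples `(f x_0, …, f x_k, g x_k, …, g x_n)`. -/
noncomputable def prismTuple (f g : V → W) : (n : ℕ) → (Fin (n + 1) → V) → K R W (n + 1)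
  | 0, p => Finsupp.single (Fin.cons (f (p 0)) (g ∘ p)) 1
  | n + 1, p => Finsupp.single (Fin.cons (f (p 0)) (g ∘ p)) 1 -
      coneK R (f (p 0)) (n + 1) (prismTuple f g n (Fin.tail p))

/-- The linear extension of `prismTuple`. -/
noncomputable def prismK (f g : V → W) (n : ℕ) : K R V n →ₗ[R] K R W (n + 1) :=
  Finsupp.linearCombination R (prismTuple R f g n)

variable {R} {f g : V → W} {n : ℕ}

lemma coneK_single (x : V) (p : Fin (n + 1) → V) :
    coneK R x n (Finsupp.single p 1) = Finsupp.single (Fin.cons x p) 1 := by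
  simp [coneK]

lemma comp_cons (g : V → W) (x : V) (p : Fin (n + 1) → V) :
    g ∘ (Fin.cons x p : Fin (n + 2) → V) = Fin.cons (g x) (g ∘ p) := by
  funext k
  refine Fin.cases rfl (fun k => rfl) k

lemma mapK_single (g : V → W) (p : Fin (n + 1) → V) :
    mapK R g n (Finsupp.single p 1) = Finsupp.single (g ∘ p) 1 := by
  simp [mapK]

lemma prismK_single (p : Fin (n + 1) → V) :
    prismK R f g n (Finsupp.single p 1) = prismTuple R f g n p := by
  simp [prismK]

lemma dK_mapK (g : V → W) (c : K R V (n + 1)) :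
    dK R W n (mapK R g (n + 1) c) = mapK R g n (dK R V n c) := by
  suffices h : (dK R W n).comp (mapK R g (n + 1)) = (mapK R g n).comp (dK R V n) from
    LinearMap.congr_fun h c
  refine Finsupp.lhom_ext' fun p => LinearMap.ext_ring ?_
  simp only [LinearMap.comp_apply, Finsupp.lsingle_apply, mapK_single, dK_single, map_sum,
    map_smul]
  rfl

lemma dK_coneK_zero (x : V) (p : Fin 1 → V) : dK R V 0 (coneK R x 0 (Finsupp.single p 1)) =
    Finsupp.single p 1 - Finsupp.single (fun _ => x) 1 := by
  rw [coneK_single, dK_single]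
  refine (Fin.sum_univ_two _).trans ?_
  have e : ∀ (q r : Fin 1 → V), q 0 = r 0 → q = r := fun q r h =>
      funext fun j => by rw [Subsingleton.elim j 0, h]
  rw [e (fun j => (Fin.cons x p : Fin 2 → V) ((0 : Fin 2).succAbove j)) p rfl,
    e (fun j => (Fin.cons x p : Fin 2 → V) ((1 : Fin 2).succAbove j)) (fun _ => x) rfl]
  simp [sub_eq_add_neg]

lemma prismTuple_cons (x : V) (p : Fin (n + 1) → V) : prismTuple R f g (n + 1) (Fin.cons x p) =
    coneK R (f x) (n + 1) (coneK R (g x) n (Finsupp.single (g ∘ p) 1)) -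
      coneK R (f x) (n + 1) (prismTuple R f g n p) := by
  rw [coneK_single, coneK_single, ← comp_cons]
  rfl

lemma prismK_coneK (x : V) (c : K R V n) : prismK R f g (n + 1) (coneK R x n c) =
    coneK R (f x) (n + 1) (coneK R (g x) n (mapK R g n c)) -
      coneK R (f x) (n + 1) (prismK R f g n c) := by
  suffices h : (prismK R f g (n + 1)).comp (coneK R x n) =
      (coneK R (f x) (n + 1)).comp ((coneK R (g x) n).comp (mapK R g n)) -
      (coneK R (f x) (n + 1)).comp (prismK R f g n) from LinearMap.congr_fun h c
  refine Finsupp.lhom_ext' fun p => LinearMap.ext_ring ?_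
  simp only [LinearMap.comp_apply, Finsupp.lsingle_apply, LinearMap.sub_apply, coneK_single x,
    mapK_single, prismK_single, prismTuple_cons]

lemma dK_prismTuple_zero (p : Fin 1 → V) : dK R W 0 (prismTuple R f g 0 p) =
    Finsupp.single (g ∘ p) 1 - Finsupp.single (f ∘ p) 1 := by
  rw [prismTuple, ← coneK_single, dK_coneK_zero]
  congr 2
  funext k
  rw [Subsingleton.elim k 0]
  rfl

/-- Prisms are built from cones by recursion on the first vertex, so the homotopy formula follows by
induction from the boundary formula for cones. The case `n = 0` is separate because the boundary of
a cone on a point has an extra term. -/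
lemma dK_prismTuple_succ (p : Fin (n + 2) → V) : dK R W (n + 1) (prismTuple R f g (n + 1) p) =
    Finsupp.single (g ∘ p) 1 - Finsupp.single (f ∘ p) 1 -
      prismK R f g n (dK R V n (Finsupp.single p 1)) := by
  induction n with
  | zero =>
    obtain ⟨x, t, rfl⟩ : ∃ x t, p = Fin.cons x t := ⟨p 0, Fin.tail p, (Fin.cons_self_tail p).symm⟩
    have h0 : prismTuple R f g 0 (fun _ => x) =
        coneK R (f x) 0 (Finsupp.single (fun _ => g x) 1) := by
      rw [coneK_single]
      rfl
    rw [prismTuple_cons, map_sub, dK_coneK, dK_coneK, dK_coneK_zero, dK_prismTuple_zero,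
      ← coneK_single x t, dK_coneK_zero, comp_cons, comp_cons, ← coneK_single, ← coneK_single,
      map_sub, map_sub, map_sub, prismK_single, prismK_single, h0]
    abel
  | succ n ih =>
    obtain ⟨x, t, rfl⟩ : ∃ x t, p = Fin.cons x t := ⟨p 0, Fin.tail p, (Fin.cons_self_tail p).symm⟩
    rw [prismTuple_cons, map_sub, dK_coneK, dK_coneK, dK_coneK, ih,
      ← coneK_single x t, dK_coneK, comp_cons, comp_cons, ← coneK_single, ← coneK_single,
      map_sub, map_sub, map_sub, map_sub, prismK_coneK, prismK_single, ← mapK_single g, dK_mapK]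
    abel

/-- Prepending `x` to elements of `C_n`. -/
noncomputable def coneC (x : V) (n : ℕ) : C R V n →ₗ[R] C R V (n + 1) :=
  mapTuple (fun p => Fin.cons x p) (fun p ⟨k, hk⟩ => ⟨k.succ, by
    rw [← Fin.succ_castSucc, Fin.cons_succ, Fin.cons_succ, hk]⟩)

lemma coneC_tupleClass (x : V) (p : Fin (n + 1) → V) :
    coneC x n (tupleClass R p) = tupleClass R (Fin.cons x p) :=
  mapTuple_tupleClass p

lemma coneC_mkQ (x : V) (k : K R V n) :
    coneC x n ((DK R V n).mkQ k) = (DK R V (n + 1)).mkQ (coneK R x n k) := rfl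

lemma coneC_mem {x : V} {S : Set (Fin (n + 1) → V)} {T : Set (Fin (n + 2) → V)}
    (h : ∀ p ∈ S, Fin.cons x p ∈ T) {c : C R V n} (hc : c ∈ tupleSpan R S) :
    coneC x n c ∈ tupleSpan R T :=
  mapTuple_mem (fun p hp _ => Or.inr (h p hp)) hc

lemma coneC_eq_zero {x : V} {c : C R V n} (hc : c ∈ tupleSpan R {p | p 0 = x}) :
    coneC x n c = 0 := by
  have : tupleSpan R {p | p 0 = x} ≤ LinearMap.ker (coneC (R := R) x n) :=
    tupleSpan_le_iff.2 fun p (hp : p 0 = x) _ => by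
      rw [LinearMap.mem_ker, coneC_tupleClass]
      exact tupleClass_of_isDegenerate ⟨0, hp.symm⟩
  exact this hc

variable (R f g) in
/-- The class of the prism on a tuple. -/
noncomputable def prismClass (n : ℕ) (p : Fin (n + 1) → V) : C R W (n + 1) :=
  (DK R W (n + 1)).mkQ (prismTuple R f g n p)

lemma prismClass_zero (p : Fin 1 → V) :
    prismClass R f g 0 p = tupleClass R (Fin.cons (f (p 0)) (g ∘ p)) := rfl

lemma prismClass_succ (p : Fin (n + 2) → V) : prismClass R f g (n + 1) p =
    tupleClass R (Fin.cons (f (p 0)) (g ∘ p)) -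
      coneC (f (p 0)) (n + 1) (prismClass R f g n (Fin.tail p)) := by
  rw [prismClass, prismTuple, map_sub, ← coneC_mkQ]
  rfl

/-- Prisms on tuples consist of paths if the tuples satisfy suitable conditions. -/
lemma prismClass_mem (Y : DiGraph.{u}) {f g : V → Y.V} (T : ∀ n, Set (Fin (n + 1) → V))
    (htail : ∀ n, ∀ p ∈ T (n + 1), Fin.tail p ∈ T n)
    (hedge : ∀ n, ∀ p ∈ T (n + 1), Y.Edge (f (p 0)) (f (p 1)))
    (hpath : ∀ n, ∀ p ∈ T n, IsDegenerate (Fin.cons (f (p 0)) (g ∘ p) : Fin (n + 2) → Y.V) ∨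
      Y.IsPath (Fin.cons (f (p 0)) (g ∘ p) : Fin (n + 2) → Y.V))
    {n : ℕ} {p : Fin (n + 1) → V} (hp : p ∈ T n) :
    prismClass R f g n p ∈ tupleSpan R {q | Y.IsPath q ∧ q 0 = f (p 0)} := by
  induction n with
  | zero => exact tupleClass_mem ((hpath 0 p hp).imp_right fun h => ⟨h, rfl⟩)
  | succ n ih =>
    rw [prismClass_succ]
    refine sub_mem (tupleClass_mem ((hpath _ p hp).imp_right fun h => ⟨h, rfl⟩))
      (coneC_mem ?_ (ih (htail n p hp)))
    rintro q ⟨hq, h0⟩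
    refine ⟨fun k => ?_, rfl⟩
    refine Fin.cases ?_ (fun k => ?_) k
    · change Y.Edge (f (p 0)) (q 0)
      rw [h0]
      exact hedge n p hp
    · rw [← Fin.succ_castSucc, Fin.cons_succ, Fin.cons_succ]
      exact hq k

/-- Needed for the prism operator to descend to `C`. A repetition after the first vertex is
inherited by the tail. If `p 0 = p 1`, all tuples in the prism on the tail start with `f (p 0)`, so
coning with that vertex kills them. -/
lemma prismClass_of_isDegenerate {p : Fin (n + 1) → V} (hp : IsDegenerate p) :
    prismClass R f g n p = 0 := by
  induction n with
  | zero => exact hp.choose.elim0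
  | succ n ih =>
    rw [prismClass_succ]
    obtain ⟨k, hk⟩ := hp
    revert hk
    refine Fin.cases (fun hk => ?_) (fun k hk => ?_) k
    · have hk : p 0 = p 1 := hk
      -- With the indiscrete digraph the path condition is vacuous; only the statement about initial
      -- vertices matters here.
      have h := prismClass_mem (R := R) (f := f) (g := g) ⟨W, fun _ _ => True, fun _ => trivial⟩
        (fun n => Set.univ) (fun _ _ _ => trivial) (fun _ _ _ => trivial)
        (fun _ _ _ => Or.inr fun _ => trivial) (Set.mem_univ (Fin.tail p))
      rw [coneC_eq_zero, sub_zero]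
      · exact tupleClass_of_isDegenerate ⟨1, congrArg g hk⟩
      · refine tupleSpan_mono (fun q hq _ => ?_) h
        exact hq.2.trans (congrArg f hk.symm)
    · have hk : p k.succ.castSucc = p k.succ.succ := hk
      rw [ih ⟨k, hk⟩, map_zero, sub_zero]
      refine tupleClass_of_isDegenerate ⟨k.succ.succ, ?_⟩
      rw [← Fin.succ_castSucc, Fin.cons_succ, Fin.cons_succ]
      exact congrArg g hk

variable (R f g) in
/-- The prism operator on `C_n`. -/
noncomputable def prismC (n : ℕ) : C R V n →ₗ[R] C R W (n + 1) :=
  (DK R V n).mapQ (DK R W (n + 1)) (prismK R f g n) (by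
    refine Submodule.span_le.2 ?_
    rintro _ ⟨p, hp, rfl⟩
    change prismK R f g n (Finsupp.single p 1) ∈ DK R W (n + 1)
    rw [prismK_single]
    exact (Submodule.Quotient.mk_eq_zero _).1 (prismClass_of_isDegenerate hp))

lemma prismC_tupleClass (p : Fin (n + 1) → V) :
    prismC R f g n (tupleClass R p) = prismClass R f g n p :=
  congrArg (DK R W (n + 1)).mkQ (prismK_single p)

lemma dC_prismC_zero (c : C R V 0) :
    dC R W 0 (prismC R f g 0 c) = mapC R g 0 c - mapC R f 0 c := by
  suffices h : (dC R W 0).comp (prismC R f g 0) = mapC R g 0 - mapC R f 0 from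
    LinearMap.congr_fun h c
  refine linearMap_ext fun p => ?_
  rw [LinearMap.comp_apply, LinearMap.sub_apply, prismC_tupleClass, mapC_tupleClass,
    mapC_tupleClass, prismClass, dC_mkQ, dK_prismTuple_zero, map_sub]
  rfl

lemma dC_prismC_succ (c : C R V (n + 1)) : dC R W (n + 1) (prismC R f g (n + 1) c) =
    mapC R g (n + 1) c - mapC R f (n + 1) c - prismC R f g n (dC R V n c) := by
  suffices h : (dC R W (n + 1)).comp (prismC R f g (n + 1)) =
      mapC R g (n + 1) - mapC R f (n + 1) - (prismC R f g n).comp (dC R V n) from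
    LinearMap.congr_fun h c
  refine linearMap_ext fun p => ?_
  simp only [LinearMap.comp_apply, LinearMap.sub_apply]
  rw [prismC_tupleClass, mapC_tupleClass,
    mapC_tupleClass, prismClass, dC_mkQ, dK_prismTuple_succ, map_sub, map_sub]
  rfl

lemma prismC_mem (Y : DiGraph.{u}) {f g : V → Y.V} (T : ∀ n, Set (Fin (n + 1) → V))
    (htail : ∀ n, ∀ p ∈ T (n + 1), Fin.tail p ∈ T n)
    (hedge : ∀ n, ∀ p ∈ T (n + 1), Y.Edge (f (p 0)) (f (p 1)))
    (hpath : ∀ n, ∀ p ∈ T n, IsDegenerate (Fin.cons (f (p 0)) (g ∘ p) : Fin (n + 2) → Y.V) ∨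
      Y.IsPath (Fin.cons (f (p 0)) (g ∘ p) : Fin (n + 2) → Y.V))
    {n : ℕ} {c : C R V n} (hc : c ∈ tupleSpan R (T n)) :
    prismC R f g n c ∈ Y.allowed R (n + 1) := by
  have : tupleSpan R (T n) ≤ (Y.allowed R (n + 1)).comap (prismC R f g n) :=
    tupleSpan_le_iff.2 fun p hp _ => by
      rw [Submodule.mem_comap, prismC_tupleClass]
      exact tupleSpan_mono (fun q hq _ => hq.1) (prismClass_mem Y T htail hedge hpath hp)
  exact this hc

end Prism

/-! ### Homotopy invariance -/

section Homotopy

variable (R : Type v) [CommRing R] {X Y : DiGraph.{u}}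

/-- The maps `f` and `g` take cycles to homologous cycles. -/
def Homologous (f g : X ⟶ Y) : Prop :=
  ∀ n, ∀ z ∈ X.Omega R n, IsCycle R n z →
    ∃ w ∈ Y.Omega R (n + 1), dC R Y.V n w = mapC R g.toFun n z - mapC R f.toFun n z

variable {R}

lemma Homologous.symm {f g : X ⟶ Y} (h : Homologous R f g) : Homologous R g f := by
  intro n z hz hc
  obtain ⟨w, hw, hw'⟩ := h n z hz hc
  exact ⟨-w, neg_mem hw, by rw [map_neg, hw', neg_sub]⟩

lemma Homologous.trans {f g h : X ⟶ Y} (h₁ : Homologous R f g) (h₂ : Homologous R g h) :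
    Homologous R f h := by
  intro n z hz hc
  obtain ⟨w, hw, hw'⟩ := h₁ n z hz hc
  obtain ⟨t, ht, ht'⟩ := h₂ n z hz hc
  exact ⟨w + t, add_mem hw ht, by rw [map_add, hw', ht']; abel⟩

lemma prismC_mem_allowed {f g : X ⟶ Y} (h : ∀ x, Y.Edge (f.toFun x) (g.toFun x)) {n : ℕ}
    {c : C R X.V n} (hc : c ∈ X.allowed R n) :
    prismC R f.toFun g.toFun n c ∈ Y.allowed R (n + 1) := by
  refine prismC_mem Y (fun n => {p | X.IsPath p}) (fun n p hp k => hp k.succ)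
    (fun n p hp => f.map_edge (hp 0)) (fun n p hp => Or.inr fun k => ?_) hc
  refine Fin.cases (h _) (fun k => ?_) k
  rw [← Fin.succ_castSucc, Fin.cons_succ, Fin.cons_succ]
  exact g.map_edge (hp k)

/-- The prism on a cycle consists of paths `f x_0 → ⋯ → f x_k → g x_k → ⋯`, and its boundary is `g z
- f z`, again allowed; so the prism belongs to `Omega`. -/
lemma homologous_of_edge {f g : X ⟶ Y} (h : ∀ x, Y.Edge (f.toFun x) (g.toFun x)) :
    Homologous R f g := by
  intro n z hz hc
  have hz' := Omega_le_allowed X hz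
  have hd : dC R Y.V n (prismC R f.toFun g.toFun n z) =
      mapC R g.toFun n z - mapC R f.toFun n z := by
    cases n with
    | zero => exact dC_prismC_zero z
    | succ n =>
      rw [dC_prismC_succ, show dC R X.V n z = 0 from hc, map_zero, sub_zero]
  refine ⟨prismC R f.toFun g.toFun n z, ⟨prismC_mem_allowed h hz', ?_⟩, hd⟩
  change dC R Y.V n _ ∈ Y.allowed R n
  rw [hd]
  exact sub_mem (mapC_mem_allowed R g n z hz') (mapC_mem_allowed R f n z hz')

lemma isCycle_mapC {V W : Type u} (f : V → W) {n : ℕ} {c : C R V n} (hc : IsCycle R n c) :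
    IsCycle R n (mapC R f n c) := by
  cases n with
  | zero => trivial
  | succ n =>
    change dC R W n _ = 0
    rw [dC_mapC, show dC R V n c = 0 from hc, map_zero]

lemma homologyIsos_of_section {p : Y ⟶ X} {s : X ⟶ Y} (hs : s ≫ p = 𝟙 X)
    (hp : Homologous R (p ≫ s) (𝟙 Y)) : homologyIsos R p := by
  have hsp {n : ℕ} (z : C R X.V n) : mapC R p.toFun n (mapC R s.toFun n z) = z := by
    rw [← mapC_comp]
    have : (fun x => p.toFun (s.toFun x)) = fun x => x := congrArg Hom.toFun hs
    rw [this, mapC_id]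
  rw [homologyIsos_iff]
  refine fun n => ⟨fun z hz hc ⟨w, hw, hw'⟩ => ?_, fun y hy hc => ?_⟩
  · obtain ⟨t, ht, ht'⟩ := hp n z hz hc
    refine ⟨t + mapC R s.toFun _ w, add_mem ht (mapC_mem_Omega R s _ w hw), ?_⟩
    have h1 : mapC R (𝟙 Y : Y ⟶ Y).toFun n z = z := mapC_id R n z
    have h2 : mapC R (p ≫ s).toFun n z = mapC R s.toFun n (mapC R p.toFun n z) :=
      mapC_comp R p.toFun s.toFun n z
    rw [map_add, ht', dC_mapC, hw', h1, h2, sub_add_cancel]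
  · refine ⟨mapC R s.toFun n y, mapC_mem_Omega R s n y hy, isCycle_mapC _ hc, 0, zero_mem _, ?_⟩
    rw [hsp, map_zero, sub_self]

end Homotopy

/-! ### The cylinder -/

section Cylinder

/-- The relation of the zigzag `0 ← 1 → 2 ← 3 → 4`. -/
def Zigzag (i j : Fin 5) : Prop :=
  i = j ∨ (i = 1 ∧ j = 0) ∨ (i = 1 ∧ j = 2) ∨ (i = 3 ∧ j = 2) ∨ (i = 3 ∧ j = 4)

instance (i j : Fin 5) : Decidable (Zigzag i j) := by
  unfold Zigzag
  infer_instance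

/-- The vertices 1 and 3 are sources and 0, 2, 4 are sinks, so two nondegenerate edges never follow
each other. -/
lemma Zigzag.eq_or_eq : ∀ {i j k : Fin 5}, Zigzag i j → Zigzag j k → i = j ∨ j = k := by
  decide

/-- The cylinder on `X`, i.e. the box product of `X` with the zigzag `0 ← 1 → 2 ← 3 → 4`. -/
def cylinder (X : DiGraph.{u}) : DiGraph.{u} where
  V := X.V × Fin 5
  Edge a b := (X.Edge a.1 b.1 ∧ a.2 = b.2) ∨ (a.1 = b.1 ∧ Zigzag a.2 b.2)
  refl _ := Or.inl ⟨X.refl _, rfl⟩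

variable {X : DiGraph.{u}}

/-- The inclusion of the copy of `X` at `i`. -/
def cylinderIncl (X : DiGraph.{u}) (i : Fin 5) : X ⟶ cylinder X :=
  ⟨fun x => (x, i), fun h => Or.inl ⟨h, rfl⟩⟩

/-- The projection of the cylinder. -/
def cylinderProj (X : DiGraph.{u}) : cylinder X ⟶ X where
  toFun a := a.1
  map_edge {a b} h := by
    rcases h with h | h
    · exact h.1
    · rw [h.1]
      exact X.refl _

/-- The map of cylinders induced by an endomorphism of the zigzag. -/
def cylinderMap (X : DiGraph.{u}) (r : Fin 5 → Fin 5) (hr : ∀ i j, Zigzag i j → Zigzag (r i) (r j)) :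
    cylinder X ⟶ cylinder X where
  toFun a := (a.1, r a.2)
  map_edge h := h.imp (fun h => ⟨h.1, congrArg r h.2⟩) (fun h => ⟨h.1, hr _ _ h.2⟩)

/-- A path can change its level only once. If it does, that costs one step, and the remaining steps
project to a path in `X`. -/
lemma cylinder_reach {n : ℕ} {a b : (cylinder X).V} (h : (cylinder X).Reach n a b) :
    (a.2 = b.2 ∧ X.Reach n a.1 b.1) ∨ (a.2 ≠ b.2 ∧ Zigzag a.2 b.2 ∧
      ∃ m, n = m + 1 ∧ X.Reach m a.1 b.1) := by
  induction n generalizing a with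
  | zero =>
    obtain rfl : a = b := h
    exact Or.inl ⟨rfl, rfl⟩
  | succ n ih =>
    obtain ⟨c, e, hc⟩ := h
    rcases e with ⟨e, h2⟩ | ⟨h1, e⟩
    · rcases ih hc with ⟨h, hr⟩ | ⟨h, hz, m, rfl, hr⟩
      · exact Or.inl ⟨h2.trans h, c.1, e, hr⟩
      · exact Or.inr ⟨h2 ▸ h, h2 ▸ hz, m + 1, rfl, c.1, e, hr⟩
    · rcases ih hc with ⟨h, hr⟩ | ⟨h, hz, m, rfl, hr⟩
      · by_cases h' : a.2 = b.2
        · exact Or.inl ⟨h', a.1, X.refl _, h1 ▸ hr⟩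
        · exact Or.inr ⟨h', h ▸ e, n, rfl, h1 ▸ hr⟩
      · have h2 : a.2 = c.2 := (e.eq_or_eq hz).resolve_right h
        exact Or.inr ⟨h2 ▸ h, h2 ▸ hz, m + 1, rfl, a.1, X.refl _, h1 ▸ hr⟩

lemma homologyIsos_cylinderProj (R : Type v) [CommRing R] (X : DiGraph.{u}) :
    homologyIsos R (cylinderProj X) := by
  refine homologyIsos_of_section (s := cylinderIncl X 2) rfl ?_
  -- Every `r i` has an edge both to `2` and to `i`, so `r` links the constant map at `2` with the
  -- identity in two homotopies.
  let r : Fin 5 → Fin 5 := ![1, 1, 2, 3, 3]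
  have hr : ∀ i j, Zigzag i j → Zigzag (r i) (r j) := by decide
  have h1 : ∀ i, Zigzag (r i) 2 := by decide
  have h2 : ∀ i, Zigzag (r i) i := by decide
  exact (homologous_of_edge (f := cylinderMap X r hr)
    (g := cylinderProj X ≫ cylinderIncl X 2) fun a => Or.inr ⟨rfl, h1 a.2⟩).symm.trans
    (homologous_of_edge (g := 𝟙 _) fun a => Or.inr ⟨rfl, h2 a.2⟩)

lemma cofibrations_of_range_eq {A : DiGraph.{u}} (f : A ⟶ cylinder X) (hf : IsInducedInclusion f)
    (hr : Set.range f.toFun = {a | a.2 = 0 ∨ a.2 = 4}) : cofibrations f := by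
  have hmem (a : A.V) : (f.toFun a).2 = 0 ∨ (f.toFun a).2 = 4 := by
    have : f.toFun a ∈ Set.range f.toFun := ⟨a, rfl⟩
    rwa [hr] at this
  rw [cofibrations_iff, hr]
  refine ⟨hf, fun a x h => ?_, fun x a n h => ?_⟩
  · rcases h with ⟨-, h⟩ | ⟨-, h⟩
    · rw [Set.mem_ofPred_eq, ← h]
      exact hmem a
    · have : ∀ {i j : Fin 5}, Zigzag i j → i = 0 ∨ i = 4 → j = 0 ∨ j = 4 := by decide
      exact this h (hmem a)
  · rcases cylinder_reach h with ⟨h, hx⟩ | ⟨hne, hz, m, rfl, hx⟩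
    · exact ⟨x, by rw [Set.mem_ofPred_eq, h]; exact hmem a, fun b _ m hm => ⟨0, m, by simp, rfl, hm⟩⟩
    · refine ⟨(x.1, (f.toFun a).2), hmem a, fun b hb k hk => ?_⟩
      -- An interior level with an edge to one end reaches no other end.
      have key : ∀ {i j l : Fin 5}, i ≠ j → Zigzag i j → j = 0 ∨ j = 4 → l = 0 ∨ l = 4 →
        (i = l ∨ Zigzag i l) → i ≠ l ∧ l = j := by decide
      rcases cylinder_reach hk with ⟨h, -⟩ | ⟨-, hz', m, rfl, hr⟩
      · exact ((key hne hz (hmem a) hb (Or.inl h)).1 h).elim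
      · obtain ⟨-, h⟩ := key hne hz (hmem a) hb (Or.inr hz')
        refine ⟨1, m, by omega, reach_one.2 (Or.inr ⟨rfl, hz⟩), ?_⟩
        obtain ⟨b, l⟩ := b
        obtain rfl : l = (f.toFun a).2 := h
        exact hr.map (cylinderIncl X _)

lemma exists_codiagonal_factorization (R : Type v) [CommRing R] (X : DiGraph.{u})
    (c : BinaryCofan X X) (hc : IsColimit c) :
    ∃ (Z : DiGraph.{u}) (i : c.pt ⟶ Z) (p : Z ⟶ X), cofibrations i ∧ homologyIsos R p ∧
      i ≫ p = hc.desc (BinaryCofan.mk (𝟙 X) (𝟙 X)) := by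
  let i : c.pt ⟶ cylinder X := hc.desc (BinaryCofan.mk (cylinderIncl X 0) (cylinderIncl X 4))
  have hl : c.inl ≫ i = cylinderIncl X 0 := hc.fac _ ⟨WalkingPair.left⟩
  have hr : c.inr ≫ i = cylinderIncl X 4 := hc.fac _ ⟨WalkingPair.right⟩
  have hl' (x : X.V) : i.toFun (c.inl.toFun x) = (x, 0) := congrArg (fun f => Hom.toFun f x) hl
  have hr' (x : X.V) : i.toFun (c.inr.toFun x) = (x, 4) := congrArg (fun f => Hom.toFun f x) hr
  have hsurj (y : c.pt.V) : (∃ x : X.V, c.inl.toFun x = y) ∨ ∃ x : X.V, c.inr.toFun x = y := by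
    obtain ⟨⟨j⟩, x, hx⟩ := exists_vertex_of_isColimit hc y
    cases j
    · exact Or.inl ⟨x, hx⟩
    · exact Or.inr ⟨x, hx⟩
  refine ⟨cylinder X, i, cylinderProj X, cofibrations_of_range_eq i ⟨fun y y' h => ?_,
    fun y y' h => ?_⟩ ?_, homologyIsos_cylinderProj R X, ?_⟩
  · rcases hsurj y with ⟨x, rfl⟩ | ⟨x, rfl⟩ <;> rcases hsurj y' with ⟨x', rfl⟩ | ⟨x', rfl⟩ <;>
      simp only [hl', hr'] at h <;>
      obtain rfl : x = x' := congrArg Prod.fst h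
    · rfl
    · exact absurd (congrArg Prod.snd h) (show (0 : Fin 5) ≠ 4 by decide)
    · exact absurd (congrArg Prod.snd h) (show (4 : Fin 5) ≠ 0 by decide)
    · rfl
  · rcases hsurj y with ⟨x, rfl⟩ | ⟨x, rfl⟩ <;> rcases hsurj y' with ⟨x', rfl⟩ | ⟨x', rfl⟩ <;>
      simp only [hl', hr'] at h <;> rcases h with ⟨h, h'⟩ | ⟨h, h'⟩ <;> dsimp only at h h'
    · exact c.inl.map_edge h
    · rw [h]; exact c.pt.refl _
    · exact absurd h' (by decide)
    · exact absurd h' (by decide)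
    · exact absurd h' (by decide)
    · exact absurd h' (by decide)
    · exact c.inr.map_edge h
    · rw [h]; exact c.pt.refl _
  · ext ⟨x, k⟩
    constructor
    · rintro ⟨y, hy⟩
      rcases hsurj y with ⟨x', rfl⟩ | ⟨x', rfl⟩
      · rw [hl'] at hy
        exact Or.inl (congrArg Prod.snd hy).symm
      · rw [hr'] at hy
        exact Or.inr (congrArg Prod.snd hy).symm
    · rintro (h | h)
      · obtain rfl : k = 0 := h
        exact ⟨_, hl' x⟩
      · obtain rfl : k = 4 := h
        exact ⟨_, hr' x⟩
  · refine BinaryCofan.IsColimit.hom_ext hc ?_ ?_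
    · rw [← Category.assoc, hl]
      exact (hc.fac (BinaryCofan.mk (𝟙 X) (𝟙 X)) ⟨WalkingPair.left⟩).symm
    · rw [← Category.assoc, hr]
      exact (hc.fac (BinaryCofan.mk (𝟙 X) (𝟙 X)) ⟨WalkingPair.right⟩).symm

end Cylinder

/-! ### Collapsing a subgraph -/

/-- The vertices outside `A` with an edge into `A`. -/
def inBoundary (X : DiGraph.{u}) (A : Set X.V) : Set X.V := {x | x ∉ A ∧ ∃ a ∈ A, X.Edge x a}

/-- The local properties of a projecting decomposition which govern the chain complexes. -/
structure IsLocalProjection (X : DiGraph.{u}) (A : Set X.V) (π : X.V → X.V) : Prop where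
  out {a x : X.V} : a ∈ A → X.Edge a x → x ∈ A
  eq {x a : X.V} : x ∉ A → a ∈ A → X.Edge x a → a = π x
  edge {x y : X.V} : x ∈ X.inBoundary A → y ∈ X.inBoundary A → X.Edge x y → X.Edge (π x) (π y)
  eq_of_edge {x y : X.V} : x ∉ A → x ∉ X.inBoundary A → y ∈ X.inBoundary A → X.Edge x y → π x = π y

/-- Only paths of length 1 and 2 into `A` are used: the chain-level argument sees nothing of the
decomposition beyond this. -/
lemma exists_isLocalProjection {A X : DiGraph.{u}} {i : A ⟶ X} (hi : cofibrations i) :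
    ∃ π, X.IsLocalProjection (Set.range i.toFun) π := by
  rw [cofibrations_iff] at hi
  obtain ⟨-, hout, hproj⟩ := hi
  have h (x : X.V) : ∃ w, ∀ a n, X.Reach n x (i.toFun a) →
      X.ProjectsTo (Set.range i.toFun) x w := by
    by_cases hx : ∃ a n, X.Reach n x (i.toFun a)
    · obtain ⟨a, n, hr⟩ := hx
      obtain ⟨w, hw⟩ := hproj x a n hr
      exact ⟨w, fun _ _ _ => hw⟩
    · exact ⟨x, fun a n hr => (hx ⟨a, n, hr⟩).elim⟩
  choose π hπ using h
  have heq {x a : X.V} (hx : x ∉ Set.range i.toFun) (ha : a ∈ Set.range i.toFun)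
      (e : X.Edge x a) : a = π x := by
    obtain ⟨a, rfl⟩ := ha
    obtain ⟨hw, h⟩ := hπ x a 1 (reach_one.2 e)
    -- The edge `x → a` splits at `π x`, which lies in `A` while `x` does not; hence `π x` is the
    -- endpoint.
    obtain ⟨p, q, hpq, hp, hq⟩ := h _ ⟨a, rfl⟩ 1 (reach_one.2 e)
    rcases p with _ | p
    · have hp : x = π x := hp
      exact (hx (by rw [hp]; exact hw)).elim
    · obtain rfl : q = 0 := by omega
      exact Eq.symm hq
  have hbd {y : X.V} (hy : y ∈ X.inBoundary (Set.range i.toFun)) :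
      X.Edge y (π y) ∧ π y ∈ Set.range i.toFun := by
    obtain ⟨hy, a, ha, e⟩ := hy
    rw [← heq hy ha e]
    exact ⟨e, ha⟩
  have key {x y : X.V} (hx : x ∉ Set.range i.toFun) (hy : y ∈ X.inBoundary (Set.range i.toFun))
      (e : X.Edge x y) : (X.Edge x (π x) ∧ π x ∈ Set.range i.toFun ∧ X.Edge (π x) (π y)) ∨
        π x = π y := by
    obtain ⟨ey, a, ha⟩ := hbd hy
    -- The path `x → y → π y` can be replaced by one through `π x`: either `π x` comes after one
    -- step and then has an edge to `π y`, or it is `π y`.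
    have hr : X.Reach 2 x (i.toFun a) := ⟨y, e, reach_one.2 (ha ▸ ey)⟩
    obtain ⟨hw, h⟩ := hπ x a 2 hr
    obtain ⟨p, q, hpq, hp, hq⟩ := h _ ⟨a, rfl⟩ 2 hr
    rcases p with _ | _ | p
    · have hp : x = π x := hp
      exact (hx (by rw [hp]; exact hw)).elim
    · obtain rfl : q = 1 := by omega
      exact Or.inl ⟨reach_one.1 hp, hw, ha ▸ reach_one.1 hq⟩
    · obtain rfl : q = 0 := by omega
      exact Or.inr (ha ▸ hq)
  refine ⟨π, ?_, heq, fun {x y} hx hy e => ?_, fun {x y} hx hx' hy e => ?_⟩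
  · rintro _ x ⟨a, rfl⟩ e
    exact hout a x e
  · rcases key hx.1 hy e with h | h
    · exact h.2.2
    · rw [h]
      exact X.refl _
  · rcases key hx hy e with h | h
    · exact (hx' ⟨hx, _, h.2.1, h.1⟩).elim
    · exact h

section Collapse

variable {X : DiGraph.{u}} {A : Set X.V} {π : X.V → X.V} {n : ℕ}

lemma IsLocalProjection.inBoundary_edge (h : X.IsLocalProjection A π) {x : X.V}
    (hx : x ∈ X.inBoundary A) : X.Edge x (π x) ∧ π x ∈ A := by
  obtain ⟨hx, a, ha, e⟩ := hx
  rw [← h.eq hx ha e]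
  exact ⟨e, ha⟩

lemma IsPath.mem_of_le (hout : ∀ {a x : X.V}, a ∈ A → X.Edge a x → x ∈ A)
    {p : Fin (n + 1) → X.V} (hp : X.IsPath p) {k l : Fin (n + 1)} (hkl : k ≤ l)
    (hk : p k ∈ A) : p l ∈ A := by
  induction l using Fin.induction with
  | zero =>
    obtain rfl : k = 0 := by simpa using hkl
    exact hk
  | succ l ih =>
    rcases hkl.eq_or_lt with rfl | hlt
    · exact hk
    · exact hout (ih (Fin.le_castSucc_iff.2 hlt)) (hp l)

/-- The paths outside `A`. -/
def outerPaths (X : DiGraph.{u}) (A : Set X.V) (n : ℕ) : Set (Fin (n + 1) → X.V) :=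
  {p | X.IsPath p ∧ ∀ k, p k ∉ A}

/-- The paths outside `A` whose last vertex has an edge into `A`. -/
def boundaryPaths (X : DiGraph.{u}) (A : Set X.V) (n : ℕ) : Set (Fin (n + 1) → X.V) :=
  {p | p ∈ X.outerPaths A n ∧ p (Fin.last n) ∈ X.inBoundary A}

lemma tail_mem_boundaryPaths {p : Fin (n + 2) → X.V} (hp : p ∈ X.boundaryPaths A (n + 1)) :
    Fin.tail p ∈ X.boundaryPaths A n :=
  ⟨⟨fun k => hp.1.1 k.succ, fun k => hp.1.2 k.succ⟩, hp.2⟩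

/-- Read the path backwards from its end in the boundary: at the first edge where it leaves the
boundary, `π` takes the same value at both ends. -/
lemma IsLocalProjection.isDegenerate_or (h : X.IsLocalProjection A π) {p : Fin (n + 1) → X.V}
    (hp : p ∈ X.boundaryPaths A n) : IsDegenerate (π ∘ p) ∨ ∀ k, p k ∈ X.inBoundary A := by
  induction n with
  | zero =>
    refine Or.inr fun k => ?_
    obtain rfl : k = Fin.last 0 := Subsingleton.elim (α := Fin 1) _ _
    exact hp.2
  | succ n ih =>
    rcases ih (tail_mem_boundaryPaths hp) with ⟨k, hk⟩ | hk
    · exact Or.inl ⟨k.succ, hk⟩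
    · by_cases h0 : p 0 ∈ X.inBoundary A
      · exact Or.inr fun k => Fin.cases h0 hk k
      · exact Or.inl ⟨0, h.eq_of_edge (hp.1.2 0) h0 (hk 0) (hp.1.1 0)⟩

lemma IsLocalProjection.isPath_comp (h : X.IsLocalProjection A π) {p : Fin (n + 1) → X.V}
    (hp : X.IsPath p) (hp' : ∀ k, p k ∈ X.inBoundary A) : X.IsPath (π ∘ p) :=
  fun k => h.edge (hp' _) (hp' _) (hp k)

lemma isDegenerate_cons {V : Type u} (x : V) {p : Fin (n + 1) → V} (hp : IsDegenerate p) :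
    IsDegenerate (Fin.cons x p : Fin (n + 2) → V) := by
  obtain ⟨k, hk⟩ := hp
  exact ⟨k.succ, by rw [← Fin.succ_castSucc, Fin.cons_succ, Fin.cons_succ, hk]⟩

lemma isPath_cons {x : X.V} {p : Fin (n + 1) → X.V} (hp : X.IsPath p) (e : X.Edge x (p 0)) :
    X.IsPath (Fin.cons x p : Fin (n + 2) → X.V) := by
  refine fun k => Fin.cases e (fun k => ?_) k
  rw [← Fin.succ_castSucc, Fin.cons_succ, Fin.cons_succ]
  exact hp k

lemma IsLocalProjection.prismC_mem_allowed {R : Type v} [CommRing R]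
    (h : X.IsLocalProjection A π) {c : C R X.V n} (hc : c ∈ tupleSpan R (X.boundaryPaths A n)) :
    prismC R (fun x => x) π n c ∈ X.allowed R (n + 1) := by
  refine prismC_mem X (X.boundaryPaths A) (fun _ _ => tail_mem_boundaryPaths)
    (fun _ _ hp => hp.1.1 0) (fun n p hp => ?_) hc
  rcases h.isDegenerate_or hp with h' | h'
  · exact Or.inl (isDegenerate_cons _ h')
  · exact Or.inr (isPath_cons (h.isPath_comp hp.1.1 h') (h.inBoundary_edge (h' 0)).1)

open scoped Classical in
/-- The function collapsing `A` to a point. -/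
noncomputable def collapse {V : Type u} (A : Set V) (x : V) : Option V :=
  if x ∈ A then none else some x

lemma collapse_of_mem {x : X.V} (hx : x ∈ A) : collapse A x = none := if_pos hx

lemma collapse_of_notMem {x : X.V} (hx : x ∉ A) : collapse A x = some x := if_neg hx

lemma collapse_eq_some {x y : X.V} (h : collapse A x = some y) : x ∉ A ∧ x = y := by
  by_cases hx : x ∈ A
  · rw [collapse_of_mem hx] at h
    cases h
  · rw [collapse_of_notMem hx] at h
    exact ⟨hx, Option.some_injective _ h⟩

lemma mem_of_collapse {x : X.V} (h : collapse A x = none) : x ∈ A := by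
  by_contra hx
  rw [collapse_of_notMem hx] at h
  cases h

/-- The digraph obtained by collapsing `A` to a point (with the vertices of `A` kept as isolated
vertices). -/
noncomputable def collapsed (X : DiGraph.{u}) (A : Set X.V) : DiGraph.{u} where
  V := Option X.V
  Edge z z' := z = z' ∨ ∃ x x', X.Edge x x' ∧ collapse A x = z ∧ collapse A x' = z'
  refl _ := Or.inl rfl

lemma collapsed_edge_some {x y : X.V} (h : (X.collapsed A).Edge (some x) (some y)) :
    x = y ∨ (X.Edge x y ∧ x ∉ A ∧ y ∉ A) := by
  rcases h with h | ⟨x', y', e, hx, hy⟩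
  · exact Or.inl (Option.some_injective _ h)
  · obtain ⟨hx', rfl⟩ := collapse_eq_some hx
    obtain ⟨hy', rfl⟩ := collapse_eq_some hy
    exact Or.inr ⟨e, hx', hy'⟩

lemma collapsed_edge_some_none {x : X.V} (h : (X.collapsed A).Edge (some x) none) :
    x ∈ X.inBoundary A := by
  rcases h with h | ⟨x', y', e, hx, hy⟩
  · cases h
  · obtain ⟨hx', rfl⟩ := collapse_eq_some hx
    exact ⟨hx', y', mem_of_collapse hy, e⟩

lemma collapsed_edge_none (hout : ∀ {a x : X.V}, a ∈ A → X.Edge a x → x ∈ A) {z : Option X.V}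
    (h : (X.collapsed A).Edge none z) : z = none := by
  rcases h with h | ⟨x', y', e, hx, rfl⟩
  · exact h.symm
  · exact collapse_of_mem (hout (mem_of_collapse hx) e)

lemma isPath_of_collapsed {p : Fin (n + 1) → X.V} (hp : (X.collapsed A).IsPath (some ∘ p)) :
    X.IsPath p := by
  intro k
  rcases collapsed_edge_some (hp k) with h | h
  · rw [h]
    exact X.refl _
  · exact h.1

/-- Vertices of `A` survive as isolated vertices, so a nondegenerate path avoids them once its
length is positive. In length 0 this fails, whence the index `n + 2`. -/
lemma mem_outerPaths_of_collapsed {p : Fin (n + 2) → X.V}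
    (hp : (X.collapsed A).IsPath (some ∘ p)) (hd : ¬ IsDegenerate p) :
    p ∈ X.outerPaths A (n + 1) := by
  have h (k : Fin (n + 1)) := (collapsed_edge_some (hp k)).resolve_left fun h => hd ⟨k, h⟩
  refine ⟨isPath_of_collapsed hp, fun k => ?_⟩
  refine Fin.lastCases ?_ (fun k => (h k).2.1) k
  exact (h (Fin.last n)).2.2

/-- The tuple obtained by appending the collapsed point. -/
def snocNone {V : Type u} (p : Fin (n + 1) → V) : Fin (n + 2) → Option V :=
  Fin.snoc (some ∘ p) none

lemma snocNone_castSucc {V : Type u} (p : Fin (n + 1) → V) (k : Fin (n + 1)) :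
    snocNone p k.castSucc = some (p k) := Fin.snoc_castSucc (α := fun _ => Option V) _ _ _

lemma snocNone_last {V : Type u} (p : Fin (n + 1) → V) : snocNone p (Fin.last (n + 1)) = none :=
  Fin.snoc_last (α := fun _ => Option V) _ _

lemma isDegenerate_snocNone {V : Type u} (p : Fin (n + 1) → V) :
    IsDegenerate (snocNone p) ↔ IsDegenerate p := by
  constructor
  · rintro ⟨k, hk⟩
    revert hk
    refine Fin.lastCases (fun hk => ?_) (fun k hk => ?_) k
    · rw [Fin.succ_last, snocNone_last, snocNone_castSucc] at hk
      cases hk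
    · rw [Fin.succ_castSucc, snocNone_castSucc, snocNone_castSucc] at hk
      exact ⟨k, Option.some_injective _ hk⟩
  · rintro ⟨k, hk⟩
    refine ⟨k.castSucc, ?_⟩
    rw [Fin.succ_castSucc, snocNone_castSucc, snocNone_castSucc, hk]

lemma snocNone_injective {V : Type u} :
    Function.Injective (snocNone : (Fin (n + 1) → V) → Fin (n + 2) → Option V) := by
  intro p q h
  funext k
  have := congrFun h k.castSucc
  rw [snocNone_castSucc, snocNone_castSucc] at this
  exact Option.some_injective _ this

lemma mem_boundaryPaths_of_collapsed {p : Fin (n + 1) → X.V}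
    (hp : (X.collapsed A).IsPath (snocNone p)) (hd : ¬ IsDegenerate p) :
    p ∈ X.boundaryPaths A n := by
  have h (k : Fin n) := hp k.castSucc
  simp only [Fin.succ_castSucc, snocNone_castSucc] at h
  have hl := hp (Fin.last n)
  rw [Fin.succ_last, snocNone_last, snocNone_castSucc] at hl
  have hl' := collapsed_edge_some_none hl
  refine ⟨⟨isPath_of_collapsed h, fun k => ?_⟩, hl'⟩
  cases n with
  | zero =>
    obtain rfl : k = Fin.last 0 := Subsingleton.elim (α := Fin 1) _ _
    exact hl'.1
  | succ n => exact (mem_outerPaths_of_collapsed h hd).2 k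

/-- No edge leaves the collapsed point except its own loop, so a nondegenerate path can visit it
only at the end. -/
lemma exists_of_isPath_collapsed (hout : ∀ {a x : X.V}, a ∈ A → X.Edge a x → x ∈ A)
    {t : Fin (n + 2) → Option X.V} (ht : (X.collapsed A).IsPath t) (hd : ¬ IsDegenerate t) :
    (∃ p ∈ X.outerPaths A (n + 1), some ∘ p = t) ∨ ∃ p ∈ X.boundaryPaths A n, snocNone p = t := by
  have hs (k : Fin (n + 1)) : ∃ x, some x = t k.castSucc := by
    rcases hk : t k.castSucc with _ | x
    · have e := ht k
      rw [hk] at e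
      exact (hd ⟨k, hk.trans (collapsed_edge_none hout e).symm⟩).elim
    · exact ⟨x, rfl⟩
  choose p hp using hs
  rcases hl : t (Fin.last (n + 1)) with _ | x
  · have e : snocNone p = t := by
      funext k
      refine Fin.lastCases ?_ (fun k => ?_) k
      · rw [snocNone_last, hl]
      · rw [snocNone_castSucc, hp]
    rw [← e] at ht hd
    exact Or.inr ⟨p, mem_boundaryPaths_of_collapsed ht
      (fun h => hd ((isDegenerate_snocNone p).2 h)), e⟩
  · have e : some ∘ (Fin.snoc p x : Fin (n + 2) → X.V) = t := by
      funext k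
      refine Fin.lastCases ?_ (fun k => ?_) k
      · rw [Function.comp_apply, Fin.snoc_last, hl]
      · rw [Function.comp_apply, Fin.snoc_castSucc, hp]
    rw [← e] at ht hd
    exact Or.inl ⟨_, mem_outerPaths_of_collapsed ht (fun h => hd (isDegenerate_comp some _ h)), e⟩

variable {R : Type v} [CommRing R]

/-- Appending the collapsed point to elements of `C_n`. -/
noncomputable def snocNoneC (V : Type u) (n : ℕ) : C R V n →ₗ[R] C R (Option V) (n + 1) :=
  mapTuple snocNone (fun p => (isDegenerate_snocNone p).2)

lemma snocNoneC_tupleClass {V : Type u} (p : Fin (n + 1) → V) :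
    snocNoneC V n (tupleClass R p) = tupleClass R (snocNone p) := mapTuple_tupleClass p

lemma dC_snocNoneC {V : Type u} (c : C R V (n + 1)) :
    dC R (Option V) (n + 1) (snocNoneC V (n + 1) c) =
      snocNoneC V n (dC R V n c) + (-1 : R) ^ (n + 2) • mapC R some (n + 1) c := by
  suffices h : (dC R (Option V) (n + 1)).comp (snocNoneC V (n + 1)) =
      (snocNoneC V n).comp (dC R V n) + (-1 : R) ^ (n + 2) • mapC R some (n + 1) from
    LinearMap.congr_fun h c
  refine linearMap_ext fun p => ?_
  simp only [LinearMap.comp_apply, LinearMap.add_apply, LinearMap.smul_apply]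
  rw [snocNoneC_tupleClass, dC_tupleClass, dC_tupleClass, mapC_tupleClass, map_sum,
    Fin.sum_univ_castSucc]
  congr 1
  · refine Finset.sum_congr rfl fun i _ => ?_
    rw [map_smul, snocNoneC_tupleClass, Fin.val_castSucc]
    congr 2
    funext k
    refine Fin.lastCases ?_ (fun k => ?_) k
    · rw [snocNone_last, Fin.succAbove_ne_last_last (Fin.castSucc_lt_last i).ne, snocNone_last]
    · rw [snocNone_castSucc, Fin.castSucc_succAbove_castSucc, snocNone_castSucc]
  · congr 2
    funext k
    rw [Fin.succAbove_last, snocNone_castSucc]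
    rfl

lemma mapC_coneC {V W : Type u} (f : V → W) (x : V) (c : C R V n) :
    mapC R f (n + 1) (coneC x n c) = coneC (f x) n (mapC R f n c) := by
  suffices h : (mapC R f (n + 1)).comp (coneC x n) = (coneC (f x) n).comp (mapC R f n) from
    LinearMap.congr_fun h c
  refine linearMap_ext fun p => ?_
  simp only [LinearMap.comp_apply]
  rw [coneC_tupleClass, mapC_tupleClass, mapC_tupleClass, coneC_tupleClass, comp_cons]

/-- Among the terms `(x_0, …, x_k, π x_k, …, π x_n)` only `k = n` survives collapsing. For `k < n`,
the part under `π` either has a repetition already or has two consecutive entries in `A`. -/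
lemma IsLocalProjection.mapC_collapse_prismClass (h : X.IsLocalProjection A π)
    {p : Fin (n + 1) → X.V} (hp : p ∈ X.boundaryPaths A n) :
    mapC R (collapse A) (n + 1) (prismClass R (fun x => x) π n p) =
      (-1 : R) ^ n • tupleClass R (snocNone p) := by
  induction n with
  | zero =>
    rw [prismClass_zero, mapC_tupleClass, pow_zero, one_smul]
    congr 1
    funext k
    refine Fin.lastCases ?_ (fun k => ?_) k
    · rw [snocNone_last]
      exact collapse_of_mem (h.inBoundary_edge hp.2).2
    · obtain rfl : k = 0 := Subsingleton.elim (α := Fin 1) _ _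
      rw [snocNone_castSucc]
      exact collapse_of_notMem (hp.1.2 0)
  | succ n ih =>
    have hdeg : IsDegenerate (collapse A ∘ (Fin.cons (p 0) (π ∘ p) : Fin (n + 3) → X.V)) := by
      rcases h.isDegenerate_or hp with h' | h'
      · exact isDegenerate_comp _ _ (isDegenerate_cons _ h')
      · exact ⟨1, (collapse_of_mem (h.inBoundary_edge (h' 0)).2).trans
          (collapse_of_mem (h.inBoundary_edge (h' 1)).2).symm⟩
    rw [prismClass_succ, map_sub, mapC_tupleClass, tupleClass_of_isDegenerate hdeg, mapC_coneC,
      ih (tail_mem_boundaryPaths hp), map_smul, coneC_tupleClass, zero_sub, pow_succ, mul_neg_one,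
      neg_smul]
    congr 3
    rw [collapse_of_notMem (hp.1.2 0), snocNone, Fin.cons_snoc_eq_snoc_cons, snocNone]
    congr 1
    funext k
    exact Fin.cases rfl (fun k => rfl) k

/-- The chains on the collapsed digraph lift to `X`. -/
lemma IsLocalProjection.exists_mapC_collapse_eq (h : X.IsLocalProjection A π)
    {e : C R (Option X.V) (n + 1)} (he : e ∈ (X.collapsed A).Omega R (n + 1)) :
    ∃ c ∈ X.Omega R (n + 1), mapC R (collapse A) (n + 1) c = e := by
  have hdec : e ∈ tupleSpan R ((fun p => some ∘ p) '' X.outerPaths A (n + 1)) ⊔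
      tupleSpan R (snocNone '' X.boundaryPaths A n) := by
    rw [← tupleSpan_union]
    exact tupleSpan_mono (fun t ht hd => exists_of_isPath_collapsed h.out ht hd) he.1
  obtain ⟨u', hu', v', hv', huv⟩ := Submodule.mem_sup.1 hdec
  obtain ⟨u, hu, hu''⟩ : ∃ u ∈ tupleSpan R (X.outerPaths A (n + 1)), mapC R some (n + 1) u = u' :=
    exists_mapTuple_eq (hφ := isDegenerate_comp some) (fun _ hq _ => hq) hu'
  obtain ⟨v, hv, hv''⟩ : ∃ v ∈ tupleSpan R (X.boundaryPaths A n), snocNoneC X.V n v = v' :=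
    exists_mapTuple_eq (fun _ hq _ => hq) hv'
  have hua : u ∈ X.allowed R (n + 1) := tupleSpan_mono (fun p hp _ => hp.1) hu
  have hva : v ∈ X.allowed R n := tupleSpan_mono (fun p hp _ => hp.1.1) hv
  -- The proposed lift: `u` stays as it is, and `v` extended by the collapsed point becomes the
  -- prism from `v` to `π v`, with the sign of its surviving term.
  have hca : u + (-1 : R) ^ n • prismC R (fun x => x) π n v ∈ X.allowed R (n + 1) :=
    add_mem hua (Submodule.smul_mem _ _ (h.prismC_mem_allowed hv))
  refine ⟨u + (-1 : R) ^ n • prismC R (fun x => x) π n v, ⟨hca, ?_⟩, ?_⟩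
  · change dC R X.V n _ ∈ X.allowed R n
    cases n with
    | zero =>
      rw [allowed_zero]
      trivial
    | succ n =>
      -- Remove from `∂e` the faces of `v` omitting the collapsed point, which are allowed. What
      -- remains has a part not ending at the collapsed point and a part ending there; these cannot
      -- cancel, so `∂u` and the extension of `∂v` are allowed separately.
      have hZ : mapC R some (n + 1) (dC R X.V (n + 1) u) +
          snocNoneC X.V n (dC R X.V n v) ∈
            tupleSpan R {q : Fin (n + 2) → Option X.V | (X.collapsed A).IsPath q} := by
        have h1 : mapC R some (n + 1) v ∈
            tupleSpan R {q : Fin (n + 2) → Option X.V | (X.collapsed A).IsPath q} := by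
          refine mapC_mem (W := Option X.V) some (fun p hp _ => Or.inr fun k => ?_) hv
          exact Or.inr ⟨p k.castSucc, p k.succ, hp.1.1 k, collapse_of_notMem (hp.1.2 _),
            collapse_of_notMem (hp.1.2 _)⟩
        have h2 : dC R (Option X.V) (n + 1) e ∈
            tupleSpan R {q : Fin (n + 2) → Option X.V | (X.collapsed A).IsPath q} := dC_mem_allowed he
        have h3 : dC R (Option X.V) (n + 1) e = mapC R some (n + 1) (dC R X.V (n + 1) u) +
            snocNoneC X.V n (dC R X.V n v) + (-1 : R) ^ (n + 2) • mapC R some (n + 1) v := by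
          rw [← huv, ← hu'', ← hv'', map_add, dC_mapC, dC_snocNoneC, ← add_assoc]
        have h4 := sub_mem h2 (Submodule.smul_mem _ ((-1 : R) ^ (n + 2)) h1)
        rwa [h3, add_sub_cancel_right] at h4
      have htop {W : Type u} {m : ℕ} (c : C R W m) : c ∈ tupleSpan R Set.univ := by
        rw [tupleSpan_univ]; trivial
      have hP : mapC R some (n + 1) (dC R X.V (n + 1) u) ∈
          tupleSpan R {q : Fin (n + 2) → Option X.V | q (Fin.last _) ≠ none} :=
        mapC_mem some (fun p _ _ => Or.inr (Option.some_ne_none _)) (htop _)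
      have hQ : snocNoneC X.V n (dC R X.V n v) ∈
          tupleSpan R {q : Fin (n + 2) → Option X.V | q (Fin.last _) = none} :=
        mapTuple_mem (fun p _ _ => Or.inr (snocNone_last p)) (htop _)
      have hPQ : Disjoint {q : Fin (n + 2) → Option X.V | q (Fin.last _) ≠ none}
          {q : Fin (n + 2) → Option X.V | q (Fin.last _) = none} :=
        Set.disjoint_left.2 fun q hq hq' => hq hq'
      have hu2 : dC R X.V (n + 1) u ∈ X.allowed R (n + 1) := by
        have h1 := mem_tupleSpan_of_mapC (Option.some_injective _)
          (mem_tupleSpan_of_add hPQ hP hQ hZ)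
        refine tupleSpan_mono ?_ h1
        intro p hp _
        exact isPath_of_collapsed hp
      have hv2 : dC R X.V n v ∈ tupleSpan R (X.boundaryPaths A n) := by
        rw [add_comm (mapC R some (n + 1) _)] at hZ
        have h1 := mem_tupleSpan_of_mapTuple (hφ := fun p => (isDegenerate_snocNone p).2)
          (fun p => (isDegenerate_snocNone p).1) snocNone_injective
          (mem_tupleSpan_of_add hPQ.symm hQ hP hZ)
        refine tupleSpan_mono ?_ h1
        intro p hp hd
        exact mem_boundaryPaths_of_collapsed hp hd
      have hπv : mapC R π (n + 1) v ∈ X.allowed R (n + 1) := by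
        refine mapC_mem π (fun p hp _ => ?_) hv
        exact (h.isDegenerate_or hp).imp_right fun h' => h.isPath_comp hp.1.1 h'
      rw [map_add, map_smul, dC_prismC_succ, mapC_id]
      exact add_mem hu2 (Submodule.smul_mem _ _
        (sub_mem (sub_mem hπv hva) (h.prismC_mem_allowed hv2)))
  · have h1 : mapC R (collapse A) (n + 1) u = mapC R some (n + 1) u := by
      have : tupleSpan R (X.outerPaths A (n + 1)) ≤
          LinearMap.eqLocus (mapC R (collapse A) (n + 1)) (mapC R some (n + 1)) :=
        tupleSpan_le_iff.2 fun p hp _ => by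
          rw [LinearMap.mem_eqLocus, mapC_tupleClass, mapC_tupleClass]
          congr 1
          funext k
          exact collapse_of_notMem (hp.2 k)
      exact this hu
    have h2 : mapC R (collapse A) (n + 1) (prismC R (fun x => x) π n v) =
        (-1 : R) ^ n • snocNoneC X.V n v := by
      have : tupleSpan R (X.boundaryPaths A n) ≤ LinearMap.eqLocus
          ((mapC R (collapse A) (n + 1)).comp (prismC R (fun x => x) π n))
          ((-1 : R) ^ n • snocNoneC X.V n) :=
        tupleSpan_le_iff.2 fun p hp _ => by
          rw [LinearMap.mem_eqLocus, LinearMap.comp_apply, prismC_tupleClass, LinearMap.smul_apply,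
            snocNoneC_tupleClass, h.mapC_collapse_prismClass hp]
      exact this hv
    rw [map_add, map_smul, h1, h2, smul_smul, ← mul_pow, neg_one_mul, neg_neg, one_pow, one_smul,
      hu'', hv'', huv]

end Collapse

/-! ### Excision -/

section Excision

variable {R : Type v} [CommRing R]

lemma face_of_lt {V : Type u} {n : ℕ} (t : Fin (n + 2) → V) {i : Fin (n + 2)} {j : Fin (n + 1)}
    (h : (j : ℕ) < i) : t (i.succAbove j) = t j.castSucc := by
  rw [Fin.succAbove_of_castSucc_lt _ _ (by simpa [Fin.lt_def] using h)]

lemma face_of_le {V : Type u} {n : ℕ} (t : Fin (n + 2) → V) {i : Fin (n + 2)} {j : Fin (n + 1)}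
    (h : (i : ℕ) ≤ j) : t (i.succAbove j) = t j.succ := by
  rw [Fin.succAbove_of_le_castSucc _ _ (by simpa [Fin.le_def] using h)]

/-! ### Chains killed by collapsing -/

section Support

variable {Y : DiGraph.{u}} {B : Set Y.V} {m : ℕ}

/-- If all paths in `e` are in `B` from the vertex `k + 1` on, then they are from the vertex `k`
on. -/
lemma mem_of_forall_succ_mem (hout : ∀ {b y : Y.V}, b ∈ B → Y.Edge b y → y ∈ B)
    (huniq : ∀ {y b b' : Y.V}, y ∉ B → b ∈ B → b' ∈ B → Y.Edge y b → Y.Edge y b' → b = b')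
    {e : C R Y.V (m + 1)} (he : e ∈ Y.Omega R (m + 1)) (k : Fin m)
    (hk : ∀ t, coeff R Y.V (m + 1) e t ≠ 0 → t k.succ.castSucc ∈ B)
    (t : Fin (m + 2) → Y.V) (ht : coeff R Y.V (m + 1) e t ≠ 0) : t k.castSucc.castSucc ∈ B := by
  classical
  have hsupp := mem_tupleSpan_iff.1 he.1
  have htp : Y.IsPath t := hsupp t ht
  by_contra hkB
  have hreg := not_isDegenerate_of_coeff_ne_zero ht
  set i₀ : Fin (m + 2) := k.succ.castSucc with hi₀
  have hi₀v : (i₀ : ℕ) = k + 1 := rfl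
  have e1 : Y.Edge (t k.castSucc.castSucc) (t i₀) := htp k.castSucc
  have e2 : Y.Edge (t i₀) (t k.succ.succ) := htp k.succ
  have hB1 : t i₀ ∈ B := hk t ht
  have hB2 : t k.succ.succ ∈ B := hout hB1 e2
  have hne : ¬ Y.Edge (t k.castSucc.castSucc) (t k.succ.succ) := fun h =>
    hreg ⟨k.succ, huniq hkB hB1 hB2 e1 h⟩
  -- The face omitting the vertex `k + 1` would need an edge from a vertex outside `B` to a second
  -- vertex of `B`. It is therefore not a path, and its coefficient in `∂e` must vanish.
  let q : Fin (m + 1) → Y.V := fun j => t (i₀.succAbove j)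
  have q1 : q k.castSucc = t k.castSucc.castSucc := face_of_lt t (by simp [hi₀v])
  have q2 : q k.succ = t k.succ.succ := face_of_le t (by simp [hi₀v])
  have hqreg : ¬ IsDegenerate q := by
    rintro ⟨j, hj⟩
    rcases lt_trichotomy (j : ℕ) k with h | h | h
    · have a1 : q j.castSucc = t j.castSucc.castSucc := face_of_lt t (by simp [hi₀v]; omega)
      have a2 : q j.succ = t j.castSucc.succ := face_of_lt t (by simp [hi₀v]; omega)
      exact hreg ⟨j.castSucc, by rw [← a1, hj, a2]⟩
    · obtain rfl : j = k := Fin.ext h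
      rw [q1, q2] at hj
      exact hkB (hj ▸ hB2)
    · have a1 : q j.castSucc = t j.succ.castSucc := face_of_le t (by simp [hi₀v]; omega)
      have a2 : q j.succ = t j.succ.succ := face_of_le t (by simp [hi₀v]; omega)
      exact hreg ⟨j.succ, by rw [← a1, hj, a2]⟩
  have hq0 : coeff R Y.V m (dC R Y.V m e) q = 0 := by
    by_contra h
    have := mem_tupleSpan_iff.1 (dC_mem_allowed he) q h k
    rw [q1, q2] at this
    exact hne this
  -- No other term of `e` has `q` as a face. Omitting an earlier vertex would put a vertex of `B` at
  -- position `k`, omitting a later one would keep the forbidden edge, and the vertex at `k + 1` is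
  -- determined by its predecessor. So the coefficient of `q` is that of `t` up to sign.
  have huq (t' : Fin (m + 2) → Y.V) (ht' : coeff R Y.V (m + 1) e t' ≠ 0) (i : Fin (m + 2))
      (hi : (fun j => t' (i.succAbove j)) = q) : i = i₀ ∧ t' = t := by
    have htp' : Y.IsPath t' := hsupp t' ht'
    have hi1 := (congrFun hi k.castSucc).trans q1
    have hi2 := (congrFun hi k.succ).trans q2
    have hii : i = i₀ := by
      rcases lt_trichotomy (i : ℕ) (k + 1) with h | h | h
      · rw [face_of_le t' (by simp; omega)] at hi1
        exact (hkB (hi1 ▸ hk t' ht')).elim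
      · exact Fin.ext h
      · rw [face_of_lt t' (by simp; omega)] at hi1
        rw [face_of_lt t' (by simpa using h)] at hi2
        refine (hne ?_).elim
        rw [← hi1, ← hi2]
        exact htp' k.castSucc
    rw [hii] at hi hi1
    refine ⟨hii, funext fun j => ?_⟩
    rcases eq_or_ne j i₀ with rfl | hj
    · refine huniq hkB (hk t' ht') hB1 ?_ e1
      rw [face_of_lt t' (by simp [hi₀v])] at hi1
      rw [← hi1]
      exact htp' k.castSucc
    · obtain ⟨l, rfl⟩ := Fin.exists_succAbove_eq hj
      exact congrFun hi l
  rw [coeff_dC hqreg, Finset.sum_eq_single t, Finset.sum_eq_single i₀] at hq0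
  · rw [if_pos rfl] at hq0
    refine ht ?_
    have h1 : (-1 : R) ^ (i₀ : ℕ) * (-1) ^ (i₀ : ℕ) = 1 := by
      rw [← mul_pow]; simp
    rw [← mul_one (coeff R Y.V (m + 1) e t), ← h1, ← mul_assoc, hq0, zero_mul]
  · intro i _ hi
    exact if_neg fun h => hi (huq t ht i h).1
  · intro h
    exact (h (Finset.mem_univ _)).elim
  · intro t' ht' hne'
    rw [Finset.sum_eq_zero, mul_zero]
    intro i _
    exact if_neg fun h => hne' (huq t' (Finsupp.mem_support_iff.1 ht') i h).2
  · intro h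
    exact (h (Finsupp.mem_support_iff.2 ht)).elim

/-- A chain which vanishes after collapsing `B` lies in `B`. -/
lemma mem_tuplesIn_of_mapC_eq_zero (hout : ∀ {b y : Y.V}, b ∈ B → Y.Edge b y → y ∈ B)
    (huniq : ∀ {y b b' : Y.V}, y ∉ B → b ∈ B → b' ∈ B → Y.Edge y b → Y.Edge y b' → b = b')
    {W : Type u} {ρ : Y.V → W} (hρ : ∀ {y y' : Y.V}, y ∉ B → ρ y = ρ y' → y = y')
    {e : C R Y.V (m + 1)} (he : e ∈ Y.Omega R (m + 1)) (h0 : mapC R ρ (m + 1) e = 0) :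
    e ∈ tupleSpan R (tuplesIn B (m + 1)) := by
  classical
  have hsupp := mem_tupleSpan_iff.1 he.1
  -- If the next-to-last vertex lies outside `B`, then `ρ ∘ t` is nondegenerate and determines `t`;
  -- a last vertex in `B` is determined by its predecessor. The coefficient of `t` would then
  -- survive in `mapC R ρ (m + 1) e`.
  have hm (t : Fin (m + 2) → Y.V) (ht : coeff R Y.V (m + 1) e t ≠ 0) :
      t (Fin.last m).castSucc ∈ B := by
    by_contra hB
    have htp : Y.IsPath t := hsupp t ht
    have hlt (k : Fin (m + 1)) : t k.castSucc ∉ B := fun h =>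
      hB (htp.mem_of_le hout (by simpa using Fin.le_last k) h)
    have hreg : ¬ IsDegenerate (ρ ∘ t) := by
      rintro ⟨k, hk⟩
      exact not_isDegenerate_of_coeff_ne_zero ht ⟨k, hρ (hlt k) hk⟩
    have h1 : coeff R W (m + 1) (mapC R ρ (m + 1) e) (ρ ∘ t) = coeff R Y.V (m + 1) e t := by
      have : mapC R ρ (m + 1) e = (DK R W (m + 1)).mkQ
          (Finsupp.mapDomain (fun p => ρ ∘ p) (coeff R Y.V (m + 1) e)) := by
        conv_lhs => rw [← mkQ_coeff e]
        rfl
      rw [this, coeff_mkQ_apply _ hreg, Finsupp.mapDomain, Finsupp.sum, Finsupp.finsetSum_apply,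
        Finset.sum_eq_single t]
      · rw [Finsupp.single_eq_same]
      · intro t' ht' hne
        rw [Finsupp.single_apply, if_neg]
        intro heq
        refine hne (funext fun k => ?_)
        have htp' : Y.IsPath t' := hsupp t' (Finsupp.mem_support_iff.1 ht')
        have h2 (k : Fin (m + 1)) : t k.castSucc = t' k.castSucc :=
          hρ (hlt k) (congrFun heq k.castSucc).symm
        refine Fin.lastCases ?_ (fun k => (h2 k).symm) k
        by_cases hl : t (Fin.last (m + 1)) ∈ B
        · by_cases hl' : t' (Fin.last (m + 1)) ∈ B
          · refine huniq (hlt (Fin.last m)) hl' hl ?_ (htp (Fin.last m))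
            rw [h2]
            exact htp' (Fin.last m)
          · exact hρ hl' (congrFun heq _)
        · exact (hρ hl (congrFun heq _).symm).symm
      · intro h
        exact (h (Finsupp.mem_support_iff.2 ht)).elim
    rw [h0, map_zero] at h1
    exact ht h1.symm
  have key (k : Fin (m + 1)) : ∀ t, coeff R Y.V (m + 1) e t ≠ 0 → t k.castSucc ∈ B := by
    induction k using Fin.reverseInduction with
    | last => exact hm
    | cast k ih => exact mem_of_forall_succ_mem hout huniq he k ih
  refine mem_tupleSpan_iff.2 fun t ht k => ?_
  exact IsPath.mem_of_le hout (hsupp t ht) (Fin.zero_le k) (key 0 t ht)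

end Support

lemma dC_mem_tuplesIn {V : Type u} {S : Set V} {n : ℕ} {c : C R V (n + 1)}
    (hc : c ∈ tupleSpan R (tuplesIn S (n + 1))) :
    dC R V n c ∈ tupleSpan R (tuplesIn S n) := by
  have : tupleSpan R (tuplesIn S (n + 1)) ≤ (tupleSpan R (tuplesIn S n)).comap (dC R V n) :=
    tupleSpan_le_iff.2 fun p hp _ => by
      rw [Submodule.mem_comap, dC_tupleClass]
      exact Submodule.sum_mem _ fun i _ => Submodule.smul_mem _ _
        (tupleClass_mem (Or.inr fun k => hp _))
  exact this hc

/-! ### Excision for pushouts along cofibrations -/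

section Pushout

variable {A X B Y : DiGraph.{u}} {i : A ⟶ X} {f : A ⟶ B} {g : X ⟶ Y} {j : B ⟶ Y}

lemma mapC_mem_tuplesIn (h : IsPushout i f g j) {n : ℕ} {c : C R X.V n}
    (hc : c ∈ tupleSpan R (tuplesIn (Set.range i.toFun) n)) :
    mapC R g.toFun n c ∈ tupleSpan R (tuplesIn (Set.range j.toFun) n) := by
  refine mapC_mem _ (fun p hp _ => Or.inr fun k => ?_) hc
  obtain ⟨a, ha⟩ := hp k
  exact ⟨f.toFun a, by rw [← pushout_condition h, ha]; rfl⟩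

/-- In a pushout along `i : A ⟶ X`, the pushout `Y` maps to the digraph obtained from `X` by
collapsing `A`. -/
lemma exists_collapse (h : IsPushout i f g j) (hi : IsInducedInclusion i) :
    ∃ ρ : Y ⟶ X.collapsed (Set.range i.toFun),
      (∀ x, ρ.toFun (g.toFun x) = collapse (Set.range i.toFun) x) ∧
      (∀ b, ρ.toFun (j.toFun b) = none) ∧
      ∀ {y y' : Y.V}, y ∉ Set.range j.toFun → ρ.toFun y = ρ.toFun y' → y = y' := by
  classical
  let ρ : Y.V → Option X.V := fun y =>
    if hy : ∃ x, x ∉ Set.range i.toFun ∧ g.toFun x = y then some hy.choose else none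
  have hg (x : X.V) : ρ (g.toFun x) = collapse (Set.range i.toFun) x := by
    by_cases hx : x ∈ Set.range i.toFun
    · rw [collapse_of_mem hx]
      refine dif_neg ?_
      rintro ⟨x', hx', e⟩
      obtain rfl := pushout_injOn h hx' e
      exact hx' hx
    · have hy : ∃ x', x' ∉ Set.range i.toFun ∧ g.toFun x' = g.toFun x := ⟨x, hx, rfl⟩
      rw [collapse_of_notMem hx, pushout_injOn h hx hy.choose_spec.2.symm]
      refine (dif_pos ?_).trans ?_
      · rwa [← pushout_injOn h hx hy.choose_spec.2.symm]
      · congr 1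
        have hy' : ∃ x', x' ∉ Set.range i.toFun ∧ g.toFun x' = g.toFun hy.choose := by
          rwa [← pushout_injOn h hx hy.choose_spec.2.symm]
        exact (pushout_injOn h hy.choose_spec.1 hy'.choose_spec.2.symm).symm
  have hj (b : B.V) : ρ (j.toFun b) = none := by
    refine dif_neg ?_
    rintro ⟨x, hx, e⟩
    exact pushout_notMem_range h hi hx ⟨b, e.symm⟩
  refine ⟨⟨ρ, fun {y y'} e => ?_⟩, hg, hj, fun {y y'} hy e => ?_⟩
  · rcases pushout_edge h e with ⟨b, b', -, rfl, rfl⟩ | ⟨x, x', e', rfl, rfl⟩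
    · exact Or.inl (by rw [hj, hj])
    · exact Or.inr ⟨x, x', e', (hg x).symm, (hg x').symm⟩
  · change ρ y = ρ y' at e
    obtain ⟨x, hx, rfl⟩ := (pushout_vertex h y).resolve_left hy
    rw [hg, collapse_of_notMem hx] at e
    rcases pushout_vertex h y' with ⟨b, rfl⟩ | ⟨x', hx', rfl⟩
    · rw [hj] at e
      cases e
    · rw [hg, collapse_of_notMem hx'] at e
      rw [Option.some_injective _ e]

lemma mem_tuplesIn_of_mapC_collapse {V : Type u} {S : Set V} {c : C R V 0}
    (hc : mapC R (collapse S) 0 c ∈ tupleSpan R (tuplesIn {none} 0)) :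
    c ∈ tupleSpan R (tuplesIn S 0) := by
  have hdec : c ∈ tupleSpan R (tuplesIn S 0) ⊔ tupleSpan R (tuplesIn Sᶜ 0) := by
    rw [← tupleSpan_union]
    have : c ∈ tupleSpan R Set.univ := by rw [tupleSpan_univ]; trivial
    refine tupleSpan_mono (fun p _ _ => ?_) this
    by_cases h : p 0 ∈ S
    · exact Or.inl fun k => by rwa [Subsingleton.elim (α := Fin 1) k 0]
    · exact Or.inr fun k => by rwa [Subsingleton.elim (α := Fin 1) k 0]
  obtain ⟨a, ha, b, hb, rfl⟩ := Submodule.mem_sup.1 hdec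
  have ha' : mapC R (collapse S) 0 a ∈ tupleSpan R (tuplesIn {none} 0) := by
    refine mapC_mem _ ?_ ha
    intro p hp _
    exact Or.inr fun k => if_pos (hp k)
  have hb' : mapC R (collapse S) 0 b = mapC R some 0 b := by
    have : tupleSpan R (tuplesIn Sᶜ 0) ≤
        LinearMap.eqLocus (mapC R (collapse S) 0) (mapC R some 0) :=
      tupleSpan_le_iff.2 fun p hp _ => by
        rw [LinearMap.mem_eqLocus, mapC_tupleClass, mapC_tupleClass]
        congr 1
        funext k
        exact if_neg (hp k)
    exact this hb
  have hb2 : mapC R some 0 b ∈ tupleSpan R (tuplesIn {none} 0) := by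
    rw [map_add, hb'] at hc
    exact (Submodule.add_mem_iff_right _ ha').1 hc
  have hb3 : b ∈ tupleSpan R (∅ : Set (Fin 1 → V)) := by
    refine tupleSpan_mono ?_ (mem_tupleSpan_of_mapC (Option.some_injective _) hb2)
    intro p hp _
    exact (Option.some_ne_none _ (hp 0)).elim
  rw [tupleSpan_empty, Submodule.mem_bot] at hb3
  rwa [hb3, add_zero]

/-- Excision: relative acyclicity is preserved by pushouts along cofibrations. -/
lemma isRelAcyclic_of_isPushout (h : IsPushout i f g j) (hi : cofibrations i)
    (hX : IsRelAcyclic R X (Set.range i.toFun)) : IsRelAcyclic R Y (Set.range j.toFun) := by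
  obtain ⟨π, hπ⟩ := exists_isLocalProjection hi
  obtain ⟨π', hπ'⟩ := exists_isLocalProjection (cofibrations_of_isPushout h hi)
  obtain ⟨ρ, hρg, hρj', hρ⟩ := exists_collapse h hi.1
  have hκ {n : ℕ} (c : C R X.V n) : mapC R ρ.toFun n (mapC R g.toFun n c) =
      mapC R (collapse (Set.range i.toFun)) n c := by
    rw [← mapC_comp]
    exact congrArg (fun φ => mapC R φ n c) (funext hρg)
  have hρj {n : ℕ} {e : C R Y.V n} (he : e ∈ tupleSpan R (tuplesIn (Set.range j.toFun) n)) :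
      mapC R ρ.toFun n e ∈ tupleSpan R (tuplesIn {none} n) := by
    refine mapC_mem _ (fun p hp _ => Or.inr fun k => ?_) he
    obtain ⟨b, hb⟩ := hp k
    exact (congrArg ρ.toFun hb).symm.trans (hρj' b)
  intro n d hd hrel
  -- Up to a chain in `B`, `d` comes from `X`. In positive degree, collapse `d` and lift to `X`; the
  -- difference dies under collapsing. In degree 0, sort the vertices instead.
  obtain ⟨c, hc, hdc⟩ : ∃ c ∈ X.Omega R n,
      d - mapC R g.toFun n c ∈ tupleSpan R (tuplesIn (Set.range j.toFun) n) := by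
    cases n with
    | zero =>
      have hdec : d ∈ tupleSpan R (tuplesIn (Set.range j.toFun) 0) ⊔
          tupleSpan R (tuplesIn (Set.range g.toFun) 0) := by
        rw [← tupleSpan_union]
        have : d ∈ tupleSpan R Set.univ := by rw [tupleSpan_univ]; trivial
        refine tupleSpan_mono (fun p _ _ => ?_) this
        rcases pushout_vertex h (p 0) with hp | ⟨x, -, hx⟩
        · exact Or.inl fun k => by rwa [Subsingleton.elim (α := Fin 1) k 0]
        · exact Or.inr fun k => ⟨x, by rwa [Subsingleton.elim (α := Fin 1) k 0]⟩
      obtain ⟨a, ha, b, hb, rfl⟩ := Submodule.mem_sup.1 hdec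
      obtain ⟨c, -, rfl⟩ := exists_mapTuple_eq (φ := fun p => g.toFun ∘ p) (S := Set.univ)
        (hφ := isDegenerate_comp g.toFun)
        (fun q hq _ => by
          choose p hp using hq
          exact ⟨p, trivial, funext hp⟩) hb
      refine ⟨c, by rw [Omega_zero]; trivial, ?_⟩
      change a + mapC R g.toFun 0 c - mapC R g.toFun 0 c ∈ _
      rwa [add_sub_cancel_right]
    | succ m =>
      obtain ⟨c, hc, hce⟩ := hπ.exists_mapC_collapse_eq (mapC_mem_Omega R ρ _ d hd)
      refine ⟨c, hc, mem_tuplesIn_of_mapC_eq_zero hπ'.out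
        (fun hy hb hb' e e' => (hπ'.eq hy hb e).trans (hπ'.eq hy hb' e').symm) hρ
        (sub_mem hd (mapC_mem_Omega R g _ c hc)) ?_⟩
      rw [map_sub, hκ, hce, sub_self]
  -- The image of `∂c` in `Y` lies in `B`, so its collapse is supported at the collapsed point. In
  -- positive degree such a chain is zero, because constant tuples are degenerate.
  have hcrel : IsRelCycle (Set.range i.toFun) n c := by
    cases n with
    | zero => trivial
    | succ m =>
      change dC R X.V m c ∈ tupleSpan R (tuplesIn (Set.range i.toFun) m)
      have h1 : mapC R g.toFun m (dC R X.V m c) ∈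
          tupleSpan R (tuplesIn (Set.range j.toFun) m) := by
        have h2 := sub_mem (show dC R Y.V m d ∈ _ from hrel) (dC_mem_tuplesIn hdc)
        rwa [map_sub, sub_sub_cancel, dC_mapC] at h2
      have h3 := hρj h1
      rw [hκ] at h3
      cases m with
      | zero => exact mem_tuplesIn_of_mapC_collapse h3
      | succ m =>
        refine mem_tuplesIn_of_mapC_eq_zero (ρ := collapse (Set.range i.toFun)) hπ.out
          (fun hy hb hb' e e' => (hπ.eq hy hb e).trans (hπ.eq hy hb' e').symm)
          (fun {y y'} hy e => ?_) (X.dC_mem_Omega R _ c hc) ?_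
        · rw [collapse_of_notMem hy] at e
          exact (collapse_eq_some e.symm).2.symm
        · have h4 : tupleSpan R (tuplesIn {none} (m + 1)) ≤
              (⊥ : Submodule R (C R (Option X.V) (m + 1))) :=
            tupleSpan_le_iff.2 fun p hp hd =>
              (hd ⟨0, (hp (Fin.castSucc 0)).trans (hp (Fin.succ 0)).symm⟩).elim
          exact (Submodule.mem_bot R).1 (h4 h3)
  obtain ⟨w, hw, hcw⟩ := hX n c hc hcrel
  refine ⟨mapC R g.toFun _ w, mapC_mem_Omega R g _ w hw, ?_⟩
  have e : d - dC R Y.V n (mapC R g.toFun (n + 1) w) =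
      (d - mapC R g.toFun n c) + mapC R g.toFun n (c - dC R X.V n w) := by
    rw [dC_mapC, map_sub]; abel
  rw [e]
  exact add_mem hdc (mapC_mem_tuplesIn h hcw)

end Pushout

end Excision

/-! ### Weak equivalences: isomorphisms and composites -/

section

variable (R : Type v) [CommRing R] {X Y Z : DiGraph.{u}}

lemma homologyIsos_of_isIso (f : X ⟶ Y) [IsIso f] : homologyIsos R f :=
  fun _ => inferInstance

lemma homologyIsos_comp (f : X ⟶ Y) (g : Y ⟶ Z) (hf : homologyIsos R f)
    (hg : homologyIsos R g) : homologyIsos R (f ≫ g) := fun n => by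
  have := hf n
  have := hg n
  rw [CategoryTheory.Functor.map_comp]
  infer_instance

end

lemma homologyIsos_of_isPushout {R : Type v} [CommRing R] {A X B Y : DiGraph.{u}} {i : A ⟶ X}
    {f : A ⟶ B} {g : X ⟶ Y} {j : B ⟶ Y} (h : IsPushout i f g j) (hi : cofibrations i)
    (hi' : homologyIsos R i) : homologyIsos R j :=
  (IsInducedInclusion.homologyIsos_iff (cofibrations_of_isPushout h hi).1).2
    (isRelAcyclic_of_isPushout h hi ((IsInducedInclusion.homologyIsos_iff hi.1).1 hi'))

end DiGraph

open DiGraph in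
theorem theorem4p1 (R : Type v) [CommRing R] :
    IsCofibrationCategory.{u} DiGraph.cofibrations.{u} (DiGraph.homologyIsos.{v, u} R) where
  id_mem _ := ⟨cofibrations_of_isIso _, homologyIsos_of_isIso R _⟩
  cof_comp := cofibrations_comp
  weq_comp := homologyIsos_comp R
  two_out_of_six := homologyIsos_two_out_of_six R
  hasInitial := (hasColimitsOfSizeShrink.{0, 0, u, u} DiGraph.{u}).has_colimits_of_shape _
  cofibrant := cofibrations_of_isInitial
  hasPushout _ _ _ := hasColimit_of_hasColimit_vertices
  cof_pushout h hi := cofibrations_of_isPushout h.flip hi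
  acyclic_pushout h hi :=
    ⟨cofibrations_of_isPushout h.flip hi.1, homologyIsos_of_isPushout h.flip hi.1 hi.2⟩
  codiagonal X c hc := exists_codiagonal_factorization R X c hc
  hasCoproducts _ := inferInstance
  hasColimit_transfinite _ _ _ _ _ _ _ _ := inferInstance
  cof_transfinite := isStableUnderTransfiniteComposition _ (fun f _ => cofibrations_of_isIso f)
    cofibrations_comp fun _ _ _ _ hc hF i => cofibrations_ι_of_isColimit hc hF i
  acyclic_transfinite := isStableUnderTransfiniteComposition _
    (fun f _ => ⟨cofibrations_of_isIso f, homologyIsos_of_isIso R f⟩)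
    (fun f g hf hg => ⟨cofibrations_comp f g hf.1 hg.1, homologyIsos_comp R f g hf.2 hg.2⟩)
    fun _ _ _ _ hc hF i => ⟨cofibrations_ι_of_isColimit hc (fun i j h => (hF i j h).1) i,
      homologyIsos_ι_of_isColimit hc (fun i j h => (hF i j h).1) (fun i j h => (hF i j h).2) i⟩
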